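/- Let $k$ be a field of characteristic zero, $K=k(x_1,\dots,x_m)$, with the partial derivatives $\partial_1,\dots,\partial_m$. Let $\mathcal U$ be a universal differential extension of $K$: a field extension of $K$ with commuting derivations $\partial_1,\dots,\partial_m$ extending those of $K$, such that every system of algebraic differential equations over $K$ in finitely many unknowns that has a solution in some differential extension field of $K$ (with commuting derivations) has a solution in $\mathcal U$. Let $\mathcal M$ be the $\mathcal U$-vector space with basis $dx_1,\dots,dx_m$; a $p$-form is an element $\sum_I f_I\,dx_I$ of $\bigwedge^p\mathcal M$. Put $d^s(\sum_I f_I\,dx_I)=\sum_I\partial_s(f_I)\,dx_s\wedge dx_I$, $d_i=d^1+\cdots+d^i$ and $d=d_m$. For $b\in\mathcal U\setminus\{0\}$, $\log b$ denotes an element of $\mathcal U$ with $\partial_s(\log b)=\partial_s(b)/b$ for all $s$. Let $p\ge 1$ and let $\omega$ be a closed $p$-form (i.e. $d\omega=0$) with coefficients in $K$. Then there are $(p-1)$-forms $\Psi^p,\dots,\Psi^m$ over $\mathcal U$ such that \[ \omega=d_p(\Psi^p)+\cdots+d_m(\Psi^m)=d(\Psi^p+\cdots+\Psi^m), \] where,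 for each $i=p,\dots,m$, every coefficient $f_{i,k}$ of $\Psi^i$ is of the form \[ f_{i,k}=b_{i,k,0}+\sum_{j>0}c_{i,k,j}\log b_{i,k,j} \] (a finite sum, with one choice of $\log b$ for each element $b$ that occurs), with $b_{i,k,0}\in k(x_1,\dots,x_i)$, $c_{i,k,j}$ algebraic over $k(x_1,\dots,x_{i-1})$, and $0\ne b_{i,k,j}\in k(x_1,\dots,x_{i-1})(c_{i,k,j})[x_i]$ for $j>0$. (If $p>m$, the sums are empty and the claim says $\omega=0$.) -/

import Mathlib

namespace RationalForms

universe u v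

/-- The field `k(x_1, …, x_m)` of rational functions; the variable `x_{i+1}` has index `i : Fin m`. -/
abbrev RatField (k : Type u) [Field k] (m : ℕ) : Type u :=
  FractionRing (MvPolynomial (Fin m) k)

/-- A structure of differential extension field of `k(x_1, …, x_m)` on the extension field `E`:
commuting derivations `∂_1, …, ∂_m` of `E` that extend the partial derivatives. (It is enough to ask
for the latter on polynomials, since a derivation of a domain is determined on fractions by the
quotient rule.) -/
structure PartialDerivations (k : Type u) [Field k] (m : ℕ) (E : Type v) [Field E]
    [Algebra (RatField k m) E] where
  /-- the derivation `∂_{i+1}` -/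
  D : Fin m → Derivation ℤ E E
  comm : ∀ (i j : Fin m) (f : E), D i (D j f) = D j (D i f)
  extends_pderiv : ∀ (i : Fin m) (P : MvPolynomial (Fin m) k),
    D i (algebraMap (RatField k m) E (algebraMap (MvPolynomial (Fin m) k) (RatField k m) P)) =
      algebraMap (RatField k m) E
        (algebraMap (MvPolynomial (Fin m) k) (RatField k m) (MvPolynomial.pderiv i P))

section

variable {k : Type u} [Field k] {m : ℕ} {E : Type v} [Field E] [Algebra (RatField k m) E]

/-- The iterated derivative `∂_{i_1} ⋯ ∂_{i_r} f` for a word `[i_1, …, i_r]`. -/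
def PartialDerivations.iter (δ : PartialDerivations k m E) (w : List (Fin m)) (f : E) : E :=
  w.foldr (fun i g => δ.D i g) f

/-- The value at `y = (y_1, …, y_n)` of a differential polynomial in `n` unknowns with
coefficients in `k(x_1, …, x_m)`: the indeterminate `(a, w)` stands for the iterated derivative of
the unknown `y_a` along the word `w`. -/
noncomputable def PartialDerivations.eval (δ : PartialDerivations k m E) {n : ℕ} (y : Fin n → E)
    (P : MvPolynomial (Fin n × List (Fin m)) (RatField k m)) : E :=
  MvPolynomial.aeval (fun z : Fin n × List (Fin m) => δ.iter z.2 (y z.1)) P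

/-- `E` is a universal differential extension of `K = k(x_1, …, x_m)`: every system of algebraic
differential equations over `K` in finitely many unknowns that has a solution in some differential
extension field of `K` has a solution in `E`. (A solution generates a differential field of
cardinality at most that of `K`, so that extensions in the universe of `k` are enough.) -/
def PartialDerivations.IsUniversal (δ : PartialDerivations k m E) : Prop :=
  ∀ (n : ℕ) (S : Set (MvPolynomial (Fin n × List (Fin m)) (RatField k m)))
    (L : Type u) [Field L] [Algebra (RatField k m) L] (ε : PartialDerivations k m L),
    (∃ y : Fin n → L, ∀ P ∈ S, ε.eval y P = 0) → ∃ y : Fin n → E, ∀ P ∈ S, δ.eval y P = 0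

variable (k m E) in
/-- The copy in `E` of `k(x_1, …, x_i)`, the subfield of `k(x_1, …, x_m)` generated over `k` by
the first `i` variables. -/
noncomputable def firstVars (i : ℕ) : Subfield E :=
  (IntermediateField.adjoin k
    {f : RatField k m | ∃ j : Fin m, (j : ℕ) < i ∧
      f = algebraMap (MvPolynomial (Fin m) k) (RatField k m) (MvPolynomial.X j)}).toSubfield.map
    (algebraMap (RatField k m) E)

variable (k E) in
/-- The variable with index `s`, as an element of `E`. -/
noncomputable def var (s : Fin m) : E :=
  algebraMap (RatField k m) E (algebraMap (MvPolynomial (Fin m) k) (RatField k m) (MvPolynomial.X s))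

/-- `l` is a logarithm of the nonzero element `b`: `dl = db / b`. -/
def PartialDerivations.IsLog (δ : PartialDerivations k m E) (l b : E) : Prop :=
  b ≠ 0 ∧ ∀ i : Fin m, δ.D i l = δ.D i b / b

/-- With `i = s + 1`: the element `f` has the form `b_0 + ∑_j c_j log b_j` (a finite sum) with
`b_0 ∈ k(x_1, …, x_i)`, `c_j` algebraic over `k(x_1, …, x_{i-1})`, and
`b_j ∈ k(x_1, …, x_{i-1})(c_j)[x_i]`, where `log b_j` is a logarithm of `b_j`. -/
def PartialDerivations.IsLogCoeff (δ : PartialDerivations k m E) (log : E → E) (s : Fin m)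
    (f : E) : Prop :=
  ∃ (n : ℕ) (b₀ : E) (c b : Fin n → E),
    b₀ ∈ firstVars k m E (s + 1) ∧
    (∀ j, IsAlgebraic (firstVars k m E s) (c j)) ∧
    (∀ j, ∃ P : Polynomial (IntermediateField.adjoin (firstVars k m E s) {c j}),
      b j = Polynomial.aeval (var k E s) P) ∧
    (∀ j, δ.IsLog (log (b j)) (b j)) ∧
    f = b₀ + ∑ j, c j * log (b j)

variable (m E) in
/-- The space of `p`-forms: the `p`-th exterior power of the `E`-vector space of `1`-forms, which
has the basis `dx_1, …, dx_m`. -/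
abbrev Form (p : ℕ) : Type v := ⋀[E]^p (Fin m → E)

/-- The `1`-form `dx_{s+1}`. -/
noncomputable def dx (s : Fin m) : Fin m → E := Pi.basisFun E (Fin m) s

/-- The coefficient of `ω` at the basis element `dx_I`, where `I` is a `p`-element subset of the
index set. -/
noncomputable def coeff {p : ℕ} (ω : Form m E p) (I : Set.powersetCard (Fin m) p) : E :=
  ((Pi.basisFun E (Fin m)).exteriorPower p).repr ω I

/-- The operator `d^s`: it maps `∑_I f_I dx_I` to `∑_I ∂_s(f_I) dx_s ∧ dx_I`, where `dx_I` is the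
exterior product of the `dx_i`, `i ∈ I`, in increasing order. -/
noncomputable def PartialDerivations.dSingle (δ : PartialDerivations k m E) (s : Fin m) {p : ℕ}
    (ω : Form m E p) : Form m E (p + 1) :=
  ∑ I : Set.powersetCard (Fin m) p, δ.D s (coeff ω I) •
    exteriorPower.ιMulti E (p + 1)
      (Fin.cons (dx s) (fun j : Fin p => dx (Set.powersetCard.ofFinEmbEquiv.symm I j)))

/-- The operator `d_i = d^1 + ⋯ + d^i`, with `i = s + 1`. -/
noncomputable def PartialDerivations.dUpTo (δ : PartialDerivations k m E) (s : Fin m) {p : ℕ}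
    (ω : Form m E p) : Form m E (p + 1) :=
  ∑ t ∈ Finset.Iic s, δ.dSingle t ω

/-- The exterior derivative `d = d^1 + ⋯ + d^m`. -/
noncomputable def PartialDerivations.d (δ : PartialDerivations k m E) {p : ℕ}
    (ω : Form m E p) : Form m E (p + 1) :=
  ∑ t : Fin m, δ.dSingle t ω

end

end RationalForms

/-!
The variables are eliminated one at a time, beginning with the last. Let `F_s = k(x_1, …, x_s)`,
and let `ω` be a closed form in `dx_1, …, dx_{s+1}` with coefficients in `F_{s+1}`. Write `ω =
dx_{s+1} ∧ α + β` with forms `α`, `β` in `dx_1, …, dx_s`. Integrating the coefficients of `α` with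
respect to `x_{s+1}` gives a form `Ψ` with `∂_{s+1} Ψ = α`, for which `ω - dΨ = β - ∑_{t ≤ s} dx_t
∧ ∂_t Ψ` no longer contains `dx_{s+1}`. What has to be proved is that the coefficients of this
difference are in `F_s` (`exists_sub_d_mem`). The process then goes on with `ω - dΨ`, which is
again closed, and stops at the latest when the number of remaining variables is smaller than the
degree, since there is then no nonzero form.

A coefficient `f_J` of `α` is a rational function of `x = x_{s+1}` over `F_s`. By
`hermite_reduction` it is the sum of a derivative and of a proper fraction with squarefree
denominator, and the latter is a sum of fractions `c_a / (x - a)`, with `a` and `c_a` algebraic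
over `F_s`. So it has the integral `b + ∑ c_a log (x - a)`. The product of the `x - a` with `c_a =
γ` has coefficients in `F_s(γ)`, because it is, up to a constant factor, a greatest common divisor
of polynomials over that field (`exists_residues`), so the integral has the required form, if the
logarithm of a product is the sum of the logarithms. The latter is achieved by choosing all
logarithms in a fixed `ℚ`-linear complement of the constants (`exists_multiplicative_log`).

That `ω` is closed says that `∂_{s+1}` of a coefficient of `β` is a linear combination, with
integral coefficients, of derivatives `∂_t f_J`, `t ≤ s`. Subtract from the coefficient of `β` the
same combination of the `∂_t` of the integrals. The derivative of a rational function has no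
residues (`residue_eq_zero`), so the logarithms in this combination have the coefficient zero, and
what remains is a rational function of `x` whose derivative vanishes: it is algebraic over `F_s`.
It differs by proper fractions from an element of `F_s(x)`, so it is equal to the constant term of
the polynomial part of that element, and is in `F_s` (`mem_range_of_eq_add_proper`). This is
`sub_sum_derivation_integral_mem`.

Universality is used only to find the roots `a` and the logarithms of the `x - a` in `U`
(`splits_and_exists_log`). They exist in `LogField k m`, where to each element of an algebraic
closure of `k(x_1, …, x_m)` an indeterminate is adjoined as its logarithm. The partial derivatives
extend to it, since separable algebraic extensions and localizations are formally étale.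
-/

namespace RationalForms

section Integration

open Polynomial

variable {U : Type*} [Field U]

/-! ### Derivations and algebraic elements -/

/-- The chain rule for a derivation that vanishes on the coefficients. -/
theorem derivation_aeval {A : Type*} [Field A] [Algebra A U] {D : Derivation ℤ U U}
    (hA : ∀ a : A, D (algebraMap A U a) = 0) (x : U) (P : A[X]) :
    D (aeval x P) = aeval x (derivative P) * D x := by
  induction P using Polynomial.induction_on' with
  | add p q hp hq => simp [hp, hq, add_mul]
  | monomial n a =>
    simp only [aeval_monomial, Derivation.leibniz, Derivation.leibniz_pow, hA, derivative_monomial,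
      smul_eq_mul, nsmul_eq_mul, map_mul, map_natCast]
    ring

/-- The chain rule for a derivation `D` that maps the field of coefficients to itself: `e` is the
value at `x` of the polynomial obtained by applying `D` to the coefficients. -/
theorem derivation_aeval_of_mem {F : Subfield U} {D : Derivation ℤ U U}
    (hF : ∀ a ∈ F, D a ∈ F) (x : U) (P : F[X]) :
    ∃ e ∈ IntermediateField.adjoin F {x},
      D (aeval x P) = e + aeval x (derivative P) * D x := by
  induction P using Polynomial.induction_on' with
  | add p q hp hq =>
    obtain ⟨e, he, h⟩ := hp
    obtain ⟨e', he', h'⟩ := hq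
    exact ⟨e + e', add_mem he he', by simp [h, h', add_mul]; ring⟩
  | monomial n a =>
    refine ⟨D a * x ^ n, mul_mem (IntermediateField.algebraMap_mem _ (⟨D a, hF a a.2⟩ : F))
      (pow_mem (IntermediateField.mem_adjoin_simple_self F x) n), ?_⟩
    have h : algebraMap F U a = (a : U) := rfl
    simp only [aeval_monomial, Derivation.leibniz, Derivation.leibniz_pow, derivative_monomial,
      smul_eq_mul, nsmul_eq_mul, map_mul, map_natCast, h]
    ring

/-- A derivation stabilizing a subfield stabilizes its algebraic closure: differentiate the
minimal polynomial relation. -/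
theorem derivation_mem_algebraicClosure [CharZero U] {F : Subfield U} {D : Derivation ℤ U U}
    (hF : ∀ a ∈ F, D a ∈ F) {a : U} (ha : IsAlgebraic F a) : IsAlgebraic F (D a) := by
  obtain ⟨e, he, h⟩ := derivation_aeval_of_mem hF a (minpoly F a)
  rw [minpoly.aeval, map_zero] at h
  have hs : aeval a (derivative (minpoly F a)) ≠ 0 :=
    (minpoly.irreducible ha.isIntegral).separable.aeval_derivative_ne_zero (minpoly.aeval F a)
  have : D a = -e / aeval a (derivative (minpoly F a)) := by
    rw [eq_div_iff hs]; linear_combination -h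
  have hle : IntermediateField.adjoin F {a} ≤ algebraicClosure F U :=
    IntermediateField.adjoin_simple_le_iff.2 (mem_algebraicClosure_iff.2 ha)
  rw [← mem_algebraicClosure_iff]
  rw [this]
  refine div_mem (neg_mem (hle he)) (hle ?_)
  exact (IntermediateField.mem_adjoin_simple_iff F _).2
    ⟨derivative (minpoly F a), 1, by rw [map_one, div_one]⟩

theorem derivation_eq_zero_of_isAlgebraic [CharZero U] {A : Type*} [Field A] [Algebra A U]
    {D : Derivation ℤ U U} (hA : ∀ a : A, D (algebraMap A U a) = 0) {a : U}
    (ha : IsAlgebraic A a) : D a = 0 := by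
  have : CharZero A := (algebraMap A U).charZero
  have h := derivation_aeval hA a (minpoly A a)
  rw [minpoly.aeval, map_zero] at h
  have hs : aeval a (derivative (minpoly A a)) ≠ 0 :=
    (minpoly.irreducible ha.isIntegral).separable.aeval_derivative_ne_zero (minpoly.aeval A a)
  exact (mul_eq_zero.1 h.symm).resolve_left hs

section Transcendental

variable {A : Type*} [Field A] [Algebra A U] {D : Derivation ℤ U U} {x : U}

/-! ### Rational functions of a primitive of `1` -/

/-- A primitive of `1` is transcendental over any field of constants. -/
theorem eq_zero_of_aeval_eq_zero [CharZero U] (hA : ∀ a : A, D (algebraMap A U a) = 0)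
    (hx : D x = 1) {P : A[X]} (hP : aeval x P = 0) : P = 0 := by
  have : CharZero A := (algebraMap A U).charZero
  induction hn : P.natDegree using Nat.strong_induction_on generalizing P with
  | _ n ih =>
    subst hn
    have h := derivation_aeval hA x P
    rw [hP, map_zero, hx, mul_one] at h
    have h0 : derivative P = 0 := by
      by_cases hd : P.natDegree = 0
      · rw [eq_C_of_natDegree_eq_zero hd, derivative_C]
      · exact ih _ (natDegree_derivative_lt hd) h.symm rfl
    have hd := derivative_eq_zero.1 h0
    rw [eq_C_of_natDegree_eq_zero hd] at hP ⊢
    simpa using hP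

theorem aeval_ne_zero [CharZero U] (hA : ∀ a : A, D (algebraMap A U a) = 0) (hx : D x = 1)
    {P : A[X]} (hP : P ≠ 0) : aeval x P ≠ 0 :=
  fun h => hP (eq_zero_of_aeval_eq_zero hA hx h)

theorem aeval_inj [CharZero U] (hA : ∀ a : A, D (algebraMap A U a) = 0) (hx : D x = 1)
    {P Q : A[X]} (h : aeval x P = aeval x Q) : P = Q :=
  sub_eq_zero.1 (eq_zero_of_aeval_eq_zero hA hx (by simp [h]))

theorem exists_coprime_of_mem_adjoin {f : U} (hf : f ∈ IntermediateField.adjoin A {x}) :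
    ∃ P Q : A[X], IsCoprime P Q ∧ Q ≠ 0 ∧ f = aeval x P / aeval x Q := by
  classical
  obtain ⟨P, Q, rfl⟩ := (IntermediateField.mem_adjoin_simple_iff A f).1 hf
  by_cases hQ : aeval x Q = 0
  · exact ⟨0, 1, isCoprime_one_right, one_ne_zero, by simp [hQ]⟩
  have hQ0 : Q ≠ 0 := fun h => hQ (by simp [h])
  obtain ⟨P', hP'⟩ := EuclideanDomain.gcd_dvd_left P Q
  obtain ⟨Q', hQ'⟩ := EuclideanDomain.gcd_dvd_right P Q
  set g := EuclideanDomain.gcd P Q with hg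
  have hg0 : g ≠ 0 := fun h => hQ0 (by rw [hQ', h, zero_mul])
  refine ⟨P', Q', ?_, fun h => hQ0 (by rw [hQ', h, mul_zero]), ?_⟩
  · refine ⟨EuclideanDomain.gcdA P Q, EuclideanDomain.gcdB P Q, mul_left_cancel₀ hg0 ?_⟩
    have := EuclideanDomain.gcd_eq_gcd_ab P Q
    rw [← hg] at this
    calc g * (EuclideanDomain.gcdA P Q * P' + EuclideanDomain.gcdB P Q * Q')
        = (g * P') * EuclideanDomain.gcdA P Q + (g * Q') * EuclideanDomain.gcdB P Q := by ring
      _ = g * 1 := by rw [← hP', ← hQ', mul_one]; exact this.symm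
  · have hgx : aeval x g ≠ 0 := fun h => hQ (by rw [hQ', map_mul, h, zero_mul])
    conv_lhs => rw [hP', hQ', map_mul, map_mul]
    rw [mul_div_mul_left _ _ hgx]

theorem aeval_div_mem_adjoin (P Q : A[X]) :
    aeval x P / aeval x Q ∈ IntermediateField.adjoin A {x} :=
  (IntermediateField.mem_adjoin_simple_iff A _).2 ⟨P, Q, rfl⟩

theorem derivation_aeval_div (hA : ∀ a : A, D (algebraMap A U a) = 0) (hx : D x = 1)
    (P Q : A[X]) : D (aeval x P / aeval x Q) =
      aeval x (derivative P * Q - P * derivative Q) / aeval x Q ^ 2 := by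
  rw [Derivation.leibniz_div, derivation_aeval hA, derivation_aeval hA, hx]
  simp only [smul_eq_mul, map_sub, map_mul]
  rw [div_eq_inv_mul, inv_pow]
  ring

/-- The constants of the rational function field `A(x)` are the elements of `A`: if `(P / Q)' = 0`
with `P`, `Q` coprime, then `Q` divides `Q'` and hence `Q' = 0`. -/
theorem mem_range_of_derivation_eq_zero [CharZero U] (hA : ∀ a : A, D (algebraMap A U a) = 0)
    (hx : D x = 1) {f : U} (hf : f ∈ IntermediateField.adjoin A {x}) (hD : D f = 0) :
    ∃ a : A, f = algebraMap A U a := by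
  have : CharZero A := (algebraMap A U).charZero
  obtain ⟨P, Q, hPQ, hQ, rfl⟩ := exists_coprime_of_mem_adjoin hf
  rw [derivation_aeval_div hA hx, div_eq_zero_iff] at hD
  have hQx := aeval_ne_zero hA hx hQ
  have h := eq_zero_of_aeval_eq_zero hA hx (hD.resolve_right (pow_ne_zero 2 hQx))
  rw [sub_eq_zero] at h
  have key : ∀ {R : A[X]}, R ∣ derivative R → derivative R = 0 := fun {R} hR => by
    by_cases hd : R.natDegree = 0
    · rw [eq_C_of_natDegree_eq_zero hd, derivative_C]
    · exact eq_zero_of_dvd_of_natDegree_lt hR (natDegree_derivative_lt hd)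
  have hQ' : derivative Q = 0 :=
    key (hPQ.symm.dvd_of_dvd_mul_left ⟨derivative P, by rw [← h]; ring⟩)
  have hP' : derivative P = 0 := by
    rw [hQ', mul_zero] at h
    exact (mul_eq_zero.1 h).resolve_right hQ
  rw [eq_C_of_natDegree_eq_zero (derivative_eq_zero.1 hP'),
    eq_C_of_natDegree_eq_zero (derivative_eq_zero.1 hQ')]
  exact ⟨P.coeff 0 / Q.coeff 0, by simp⟩

/-! ### Partial fractions and residues -/

/-- A sum of simple fractions over a common denominator. -/
theorem sum_simple_fractions [DecidableEq A] (T : Finset A) (e : A → A)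
    (hT : ∀ α ∈ T, x - algebraMap A U α ≠ 0) :
    ∑ α ∈ T, algebraMap A U (e α) / (x - algebraMap A U α) =
      aeval x (∑ α ∈ T, C (e α) * ∏ β ∈ T.erase α, (X - C β)) /
        aeval x (∏ α ∈ T, (X - C α)) := by
  have hD : aeval x (∏ α ∈ T, (X - C α)) = ∏ α ∈ T, (x - algebraMap A U α) := by simp
  rw [eq_div_iff (by rw [hD]; exact Finset.prod_ne_zero_iff.2 hT), hD, Finset.sum_mul, map_sum]
  refine Finset.sum_congr rfl fun α hα => ?_
  rw [← Finset.mul_prod_erase T _ hα]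
  have := hT α hα
  simp only [map_mul, map_prod, map_sub, aeval_X, aeval_C]
  field_simp

theorem degree_sum_simple_fractions_lt [DecidableEq A] (T : Finset A) (e : A → A) :
    (∑ α ∈ T, C (e α) * ∏ β ∈ T.erase α, (X - C β)).degree < (∏ α ∈ T, (X - C α)).degree := by
  have hd : (∏ α ∈ T, (X - C α)).degree = (T.card : WithBot ℕ) := by
    rw [degree_prod]; simp
  rw [hd, ← mem_degreeLT]
  refine Submodule.sum_mem _ fun α hα => ?_
  rw [mem_degreeLT]
  calc (C (e α) * ∏ β ∈ T.erase α, (X - C β)).degree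
      ≤ (∏ β ∈ T.erase α, (X - C β)).degree := by
        rw [degree_mul]
        calc _ ≤ 0 + _ := add_le_add_left degree_C_le _
          _ = _ := zero_add _
    _ = ((T.erase α).card : WithBot ℕ) := by rw [degree_prod]; simp
    _ < _ := by exact_mod_cast Finset.card_erase_lt_of_mem hα

/-- A derivative in `A(x)` has no residues. If `R = P / Q` has a pole at `α`, then its derivative
has a multiple pole there, unlike a sum of simple fractions; otherwise evaluate at `α` after
clearing denominators. -/
theorem residue_eq_zero [CharZero U] (hA : ∀ a : A, D (algebraMap A U a) = 0) (hx : D x = 1)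
    (T : Finset A) (e : A → A) {R : U} (hR : R ∈ IntermediateField.adjoin A {x})
    (h : ∑ α ∈ T, algebraMap A U (e α) / (x - algebraMap A U α) = D R) :
    ∀ α ∈ T, e α = 0 := by
  classical
  have : CharZero A := (algebraMap A U).charZero
  intro α hα
  obtain ⟨P, Q, hPQ, hQ, rfl⟩ := exists_coprime_of_mem_adjoin hR
  have hQx := aeval_ne_zero hA hx hQ
  have hne : ∀ α ∈ T, x - algebraMap A U α ≠ 0 := fun α _ => by
    simpa using aeval_ne_zero hA hx (X_sub_C_ne_zero α)
  rw [sum_simple_fractions T e hne, derivation_aeval_div hA hx, div_eq_div_iff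
    (aeval_ne_zero hA hx (Finset.prod_ne_zero_iff.2 fun α _ => X_sub_C_ne_zero α))
    (pow_ne_zero 2 hQx), ← map_pow, ← map_mul, ← map_mul] at h
  replace h := aeval_inj hA hx h
  set W := ∑ α ∈ T, C (e α) * ∏ β ∈ T.erase α, (X - C β) with hW
  have hWα : W.eval α = e α * ∏ β ∈ T.erase α, (α - β) := by
    rw [hW, eval_finsetSum, Finset.sum_eq_single_of_mem α hα]
    · simp [eval_prod]
    · intro β _ hβ
      rw [eval_mul, eval_prod, Finset.prod_eq_zero (Finset.mem_erase.2 ⟨hβ.symm, hα⟩) (by simp),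
        mul_zero]
  have hprod : ∏ β ∈ T.erase α, (α - β) ≠ 0 :=
    Finset.prod_ne_zero_iff.2 fun β hβ => sub_ne_zero.2 (Finset.ne_of_mem_erase hβ).symm
  rw [← Finset.mul_prod_erase T _ hα] at h
  set D1 := ∏ β ∈ T.erase α, (X - C β) with hD1
  have hD1α : D1.eval α ≠ 0 := by simpa [hD1, eval_prod] using hprod
  obtain ⟨Q1, hQ1, hndvd⟩ := exists_eq_pow_rootMultiplicity_mul_and_not_dvd Q hQ α
  have hQ1α : Q1.eval α ≠ 0 := fun h => hndvd (dvd_iff_isRoot.2 h)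
  rcases hn : rootMultiplicity α Q with _ | n
  · rw [hn, pow_zero, one_mul] at hQ1
    have := congrArg (eval α) h
    simp only [eval_mul, eval_pow, eval_sub, eval_X, eval_C, sub_self, zero_mul, mul_zero] at this
    rcases mul_eq_zero.1 this with h1 | h1
    · rw [hWα] at h1
      exact (mul_eq_zero.1 h1).resolve_right hprod
    · rw [hQ1] at h1
      exact absurd h1 (pow_ne_zero 2 hQ1α)
  · exfalso
    rw [hn] at hQ1
    have hPα : P.eval α ≠ 0 := by
      intro h0
      obtain ⟨u, v, huv⟩ := hPQ
      have := congrArg (eval α) huv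
      rw [hQ1] at this
      simp [h0] at this
    -- after cancelling `(X - α) ^ (n + 1)`, evaluate both sides at `α`
    have h2 : (X - C α) ^ (n + 1) * (W * (X - C α) ^ (n + 1) * Q1 ^ 2) = (X - C α) ^ (n + 1) *
        (((X - C α) * (derivative P * Q1 - P * derivative Q1) - C ((n : A) + 1) * P * Q1) *
          D1) := by
      have hder : derivative Q = C ((n : A) + 1) * (X - C α) ^ n * Q1 +
          (X - C α) ^ (n + 1) * derivative Q1 := by
        rw [hQ1, derivative_mul, derivative_X_sub_C_pow]
        push_cast
        simp
      rw [hder] at h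
      generalize derivative P = P' at *
      generalize derivative Q1 = Q1' at *
      generalize C ((n : A) + 1) = c at *
      subst hQ1
      linear_combination h
    have h3 := congrArg (eval α) (mul_left_cancel₀ (pow_ne_zero _ (X_sub_C_ne_zero α)) h2)
    simp only [eval_mul, eval_pow, eval_sub, eval_X, eval_C, sub_self, zero_mul, zero_sub,
      pow_succ, mul_zero] at h3
    have h4 : (n : A) + 1 ≠ 0 := by exact_mod_cast n.succ_ne_zero
    have h5 : (-(((n : A) + 1) * P.eval α * Q1.eval α) * D1.eval α) ≠ 0 :=
      mul_ne_zero (neg_ne_zero.2 (mul_ne_zero (mul_ne_zero h4 hPα) hQ1α)) hD1α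
    exact h5 h3.symm

/-- An element `a` of an extension `A` of `F` is in `F` as soon as it is the sum of a rational
function `f` over `F` and a proper fraction over `A`: it is then the polynomial part of `f`. -/
theorem mem_range_of_eq_add_proper [CharZero U] {F : Type*} [Field F] [Algebra F A] [Algebra F U]
    [IsScalarTower F A U]
    (hA : ∀ a : A, D (algebraMap A U a) = 0) (hx : D x = 1) {a : A} {f : U}
    (hf : f ∈ IntermediateField.adjoin F {x}) {P Q : A[X]} (hPQ : P.degree < Q.degree)
    (h : algebraMap A U a = f + aeval x P / aeval x Q) : ∃ c : F, a = algebraMap F A c := by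
  obtain ⟨N, M, -, hM, rfl⟩ := exists_coprime_of_mem_adjoin hf
  have hQ : Q ≠ 0 := fun h0 => by simp [h0] at hPQ
  set φ := algebraMap F A
  have haev : ∀ R : F[X], aeval x R = aeval x (R.map φ) :=
    fun R => (aeval_map_algebraMap A x R).symm
  have hM' : M.map φ ≠ 0 := (Polynomial.map_ne_zero_iff φ.injective).2 hM
  have hNM := EuclideanDomain.div_add_mod N M
  have hr : (N % M).degree < M.degree := EuclideanDomain.mod_lt N hM
  have hMx := aeval_ne_zero hA hx hM'
  have hQx := aeval_ne_zero hA hx hQ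
  -- clearing denominators, `a` minus the polynomial part is a proper fraction
  have key : (C a - (N / M).map φ) * (M.map φ * Q) = (N % M).map φ * Q + P * M.map φ := by
    have h1 : C a * (M.map φ * Q) = N.map φ * Q + P * M.map φ := by
      apply aeval_inj hA hx
      simp only [map_mul, map_add, aeval_C, h, haev]
      field_simp
    have h2 : N.map φ = M.map φ * (N / M).map φ + (N % M).map φ := by
      rw [← Polynomial.map_mul, ← Polynomial.map_add, hNM]
    rw [sub_mul, h1, h2]
    ring
  have h0 : C a - (N / M).map φ = 0 := by
    by_contra hne
    have hlt : ((N % M).map φ * Q + P * M.map φ).degree < (M.map φ * Q).degree := by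
      have hMd : (M.map φ).degree = M.degree := degree_map _ _
      refine lt_of_le_of_lt (degree_add_le _ _) (max_lt ?_ ?_)
      · rw [degree_mul, degree_mul, degree_map, hMd]
        exact WithBot.add_lt_add_right (degree_ne_bot.2 hQ) hr
      · rw [degree_mul, degree_mul, add_comm]
        exact WithBot.add_lt_add_left (degree_ne_bot.2 hM') hPQ
    rw [← key, degree_mul (p := C a - _)] at hlt
    refine absurd hlt (not_lt.2 ?_)
    calc (M.map φ * Q).degree = 0 + (M.map φ * Q).degree := (zero_add _).symm
      _ ≤ _ := add_le_add_left (zero_le_degree_iff.2 hne) _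
  refine ⟨(N / M).coeff 0, ?_⟩
  have := congrArg (fun R : A[X] => Polynomial.coeff R 0) (sub_eq_zero.1 h0)
  simpa using this

/-! ### Integration of rational functions -/

theorem exists_derivative_eq {F : Type*} [Field F] [CharZero F] (P : F[X]) :
    ∃ Q : F[X], derivative Q = P := by
  induction P using Polynomial.induction_on' with
  | add p q hp hq =>
    obtain ⟨p', rfl⟩ := hp
    obtain ⟨q', rfl⟩ := hq
    exact ⟨p' + q', derivative_add⟩
  | monomial n a =>
    refine ⟨monomial (n + 1) (a / (n + 1)), ?_⟩
    have : (n : F) + 1 ≠ 0 := by exact_mod_cast n.succ_ne_zero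
    rw [derivative_monomial]
    push_cast
    rw [div_mul_cancel₀ _ this]

/-- Hermite reduction: up to a derivative, a rational function is a proper fraction with squarefree
denominator. For an irreducible factor `p` of multiplicity `i + 2` in the denominator, a Bézout
relation between `p` and `p' * E` lowers the multiplicity. -/
theorem hermite_reduction [CharZero U] (hA : ∀ a : A, D (algebraMap A U a) = 0) (hx : D x = 1)
    (N M : A[X]) (hM : M ≠ 0) :
    ∃ b ∈ IntermediateField.adjoin A {x}, ∃ N' M' : A[X], Squarefree M' ∧ N'.degree < M'.degree ∧
      aeval x N / aeval x M = D b + aeval x N' / aeval x M' := by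
  have : CharZero A := (algebraMap A U).charZero
  induction hn : M.natDegree using Nat.strong_induction_on generalizing N M with
  | _ n ih =>
  subst hn
  by_cases hsq : Squarefree M
  · obtain ⟨Q, hQ⟩ := exists_derivative_eq (N / M)
    refine ⟨aeval x Q, ?_, N % M, M, hsq, EuclideanDomain.mod_lt N hM, ?_⟩
    · simpa using aeval_div_mem_adjoin (x := x) Q 1
    · have hMx := aeval_ne_zero hA hx hM
      rw [derivation_aeval hA, hx, hQ, mul_one]
      conv_lhs => rw [← EuclideanDomain.div_add_mod N M]
      rw [map_add, map_mul]
      field_simp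
  · rw [squarefree_iff_irreducible_sq_not_dvd_of_ne_zero hM] at hsq
    push Not at hsq
    obtain ⟨p, hp, hpM⟩ := hsq
    obtain ⟨E, hE, hpE⟩ :=
      (FiniteMultiplicity.of_not_isUnit hp.not_isUnit hM).exists_eq_pow_mul_and_not_dvd
    obtain ⟨i, hi⟩ : ∃ i, multiplicity p M = i + 2 := by
      refine ⟨multiplicity p M - 2, (Nat.sub_add_cancel ?_).symm⟩
      refine (FiniteMultiplicity.of_not_isUnit hp.not_isUnit hM).le_multiplicity_of_pow_dvd ?_
      rwa [sq]
    rw [hi] at hE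
    have hp0 := hp.ne_zero
    have hE0 : E ≠ 0 := fun h => hpE (h ▸ dvd_zero p)
    obtain ⟨u, v, huv⟩ : IsCoprime p (derivative p * E) :=
      IsCoprime.mul_right hp.separable ((hp.coprime_iff_not_dvd).2 hpE)
    have hi0 : (i : A) + 1 ≠ 0 := by exact_mod_cast i.succ_ne_zero
    -- write `N = N * u * p + N * v * p' * E`; up to the term `-R' / p ^ (i + 1)`, the second
    -- summand, divided by `p ^ (i + 2) * E`, is the derivative of `-R / p ^ (i + 1)`
    set R := C ((i : A) + 1)⁻¹ * (N * v) with hR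
    have hlt : (p ^ (i + 1) * E).natDegree < M.natDegree := by
      rw [hE, natDegree_mul (pow_ne_zero _ hp0) hE0, natDegree_mul (pow_ne_zero _ hp0) hE0,
        natDegree_pow, natDegree_pow]
      have := hp.natDegree_pos
      nlinarith
    obtain ⟨b, hb, N', M', hM', hd, h⟩ := ih _ hlt (N * u + derivative R * E) (p ^ (i + 1) * E)
      (mul_ne_zero (pow_ne_zero _ hp0) hE0) rfl
    refine ⟨b - aeval x R / aeval x (p ^ (i + 1)), sub_mem hb (aeval_div_mem_adjoin _ _),
      N', M', hM', hd, ?_⟩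
    rw [map_sub, sub_add_eq_add_sub, ← h, derivation_aeval_div hA hx, derivative_pow,
      Nat.add_sub_cancel, eq_sub_iff_add_eq, hE]
    have hpx := aeval_ne_zero hA hx hp0
    have hEx := aeval_ne_zero hA hx hE0
    have hRN : (C ((i : A) + 1)) * R = N * v := by
      rw [hR, ← mul_assoc, ← C_mul, mul_inv_cancel₀ hi0, C_1, one_mul]
    have huv' := congrArg (aeval x) huv
    have hRN' := congrArg (aeval x) hRN
    simp only [map_mul, map_add, map_one, map_pow, map_sub, map_natCast] at huv' hRN' ⊢
    push_cast
    field_simp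
    generalize aeval x (derivative R) = R' at *
    generalize aeval x (derivative p) = p' at *
    generalize aeval x R = r at *
    generalize aeval x N = N at *
    generalize aeval x p = p at *
    generalize aeval x E = e at *
    generalize aeval x u = u at *
    generalize aeval x v = v at *
    linear_combination p ^ (2 * i + 2) * ((-N) * huv' - (p' * e) * hRN')

end Transcendental

theorem eq_C_mul_prod_roots {A : Type*} [Field A] [DecidableEq A] {P : A[X]} (hP : P.Splits)
    (hn : P.roots.Nodup) : P = C P.leadingCoeff * ∏ α ∈ P.roots.toFinset, (X - C α) := by
  conv_lhs => rw [hP.eq_prod_roots]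
  rw [Finset.prod, Multiset.toFinset_val, hn.dedup]

open Classical in
/-- The logarithmic part of the integral of a proper fraction with squarefree denominator `M`. The
residue at a root `α` of `M` is `N α / M' α`, so that the roots with residue `γ` are those of the
greatest common divisor of `M` and `N - γ M'`, which has coefficients in `F(γ)`. -/
theorem exists_residues [CharZero U] {F : Type*} [Field F] [Algebra F U] {D : Derivation ℤ U U}
    {x : U} (hF : ∀ a : F, D (algebraMap F U a) = 0) (hx : D x = 1) {N M : F[X]}
    (hM : Squarefree M) (hNM : N.degree < M.degree) (hs : (M.map (algebraMap F U)).Splits) :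
    ∃ (T : Finset (algebraicClosure F U)) (c : algebraicClosure F U → algebraicClosure F U),
      aeval x N / aeval x M =
        ∑ α ∈ T, algebraMap _ U (c α) / (x - algebraMap _ U α) ∧
      ∀ γ, ∃ P : (IntermediateField.adjoin F {algebraMap _ U γ})[X],
        ∏ α ∈ T with c α = γ, (x - algebraMap _ U α) = aeval x P := by
  have : CharZero F := (algebraMap F U).charZero
  set A := algebraicClosure F U with hAdef
  have hA : ∀ a : A, D (algebraMap A U a) = 0 := fun a =>
    derivation_eq_zero_of_isAlgebraic hF (mem_algebraicClosure_iff.1 a.2)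
  have hM0 : M ≠ 0 := hM.ne_zero
  set MA := M.map (algebraMap F A) with hMA
  set NA := N.map (algebraMap F A) with hNA
  have hMA0 : MA ≠ 0 := (Polynomial.map_ne_zero_iff (algebraMap F A).injective).2 hM0
  have hsep : MA.Separable := (PerfectField.separable_iff_squarefree.2 hM).map
  have hsplit : MA.Splits := by
    refine Splits.of_splits_map (algebraMap A U) ?_ fun a ha => ?_
    · rwa [hMA, Polynomial.map_map, ← IsScalarTower.algebraMap_eq]
    · rw [hMA, Polynomial.map_map, ← IsScalarTower.algebraMap_eq] at ha
      have ha' : IsAlgebraic F a := ⟨M, hM0, by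
        rw [aeval_def, ← eval_map]; exact isRoot_of_mem_roots ha⟩
      exact ⟨⟨a, mem_algebraicClosure_iff.2 ha'⟩, rfl⟩
  have hnodup : MA.roots.Nodup := nodup_roots hsep
  have haev : ∀ R : F[X], aeval x R = aeval x (R.map (algebraMap F A)) :=
    fun R => (aeval_map_algebraMap A x R).symm
  have hne : ∀ α : A, x - algebraMap A U α ≠ 0 := fun α => by
    simpa using aeval_ne_zero hA hx (X_sub_C_ne_zero α)
  set T := MA.roots.toFinset with hT
  set c : A → A := fun α => NA.eval α / (derivative MA).eval α with hc
  have hTmem : ∀ α, α ∈ T ↔ MA.eval α = 0 := fun α => by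
    rw [hT, Multiset.mem_toFinset, mem_roots hMA0, IsRoot.def]
  have hfac : MA = C MA.leadingCoeff * ∏ α ∈ T, (X - C α) := eq_C_mul_prod_roots hsplit hnodup
  have hl : MA.leadingCoeff ≠ 0 := leadingCoeff_ne_zero.2 hMA0
  have hder0 : ∀ α ∈ T, (derivative MA).eval α ≠ 0 := fun α hα => by
    have := hsep.aeval_derivative_ne_zero (x := α) (by simpa using (hTmem α).1 hα)
    simpa using this
  refine ⟨T, c, ?_, fun γ => ?_⟩
  · rw [sum_simple_fractions T c fun α _ => hne α, haev, haev]
    change aeval x NA / aeval x MA = _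
    have hder : ∀ α ∈ T, (derivative MA).eval α =
        MA.leadingCoeff * ∏ β ∈ T.erase α, (α - β) := fun α hα => by
      conv_lhs => rw [hfac, derivative_C_mul, eval_mul, eval_C]
      have := Lagrange.eval_nodal_derivative_eval_node_eq (v := (id : A → A)) hα
      simp only [Lagrange.nodal, id] at this
      rw [this, eval_prod]
      simp
    -- Lagrange interpolation: both sides have degree less than `#T` and agree on `T`
    have hW : NA = C MA.leadingCoeff * ∑ α ∈ T, C (c α) * ∏ β ∈ T.erase α, (X - C β) := by
      have hcard : MA.degree = (T.card : WithBot ℕ) := by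
        conv_lhs => rw [hfac, degree_C_mul hl, degree_prod]
        simp
      refine eq_of_degrees_lt_of_eval_finset_eq T ?_ ?_ fun α hα => ?_
      · rw [← hcard, hNA, hMA, degree_map, degree_map]
        exact hNM
      · rw [degree_C_mul hl, ← hcard]
        conv_rhs => rw [hfac, degree_C_mul hl]
        exact degree_sum_simple_fractions_lt T c
      · rw [eval_mul, eval_C, eval_finsetSum, Finset.sum_eq_single_of_mem α hα]
        · have h1 := hder0 α hα
          have h2 := hder α hα
          rw [eval_mul, eval_C, eval_prod]
          simp only [eval_sub, eval_X, eval_C]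
          rw [mul_left_comm, ← h2]
          simp only [hc]
          rw [div_mul_cancel₀ _ h1]
        · intro β _ hβ
          rw [eval_mul, eval_prod,
            Finset.prod_eq_zero (Finset.mem_erase.2 ⟨hβ.symm, hα⟩) (by simp), mul_zero]
    have hlx : aeval x (C MA.leadingCoeff) ≠ 0 := by
      rw [aeval_C]; exact (_root_.map_ne_zero _).2 hl
    rw [← mul_div_mul_left _ (aeval x (∏ α ∈ T, (X - C α))) hlx, ← map_mul, ← map_mul, ← hfac, ← hW]
  · set E := IntermediateField.adjoin F {algebraMap A U γ} with hE
    have hEA : E ≤ A := IntermediateField.adjoin_simple_le_iff.2 γ.2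
    set ι : E →ₐ[F] A := IntermediateField.inclusion hEA with hι
    set γE : E := ⟨algebraMap A U γ, IntermediateField.mem_adjoin_simple_self F _⟩ with hγE
    have hγ : ι γE = γ := rfl
    set ME := M.map (algebraMap F E) with hME
    set NE := N.map (algebraMap F E) with hNE
    have hcomp : (ι : E →+* A).comp (algebraMap F E) = algebraMap F A := ι.comp_algebraMap
    have hMEA : ME.map (ι : E →+* A) = MA := by rw [hME, Polynomial.map_map, hcomp]
    have hNEA : NE.map (ι : E →+* A) = NA := by rw [hNE, Polynomial.map_map, hcomp]
    set G := EuclideanDomain.gcd ME (NE - C γE * derivative ME) with hG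
    have hGM : G.map (ι : E →+* A) ∣ MA := by
      rw [← hMEA]; exact Polynomial.map_dvd _ (EuclideanDomain.gcd_dvd_left _ _)
    have hG0 : G.map (ι : E →+* A) ≠ 0 := fun h => hMA0 (by rwa [h, zero_dvd_iff] at hGM)
    have hroots : (G.map (ι : E →+* A)).roots.toFinset = T.filter fun α => c α = γ := by
      ext α
      rw [Multiset.mem_toFinset, mem_roots hG0, IsRoot.def, eval_map, root_gcd_iff_root_left_right,
        ← eval_map, ← eval_map, hMEA, Polynomial.map_sub, Polynomial.map_mul, map_C,
        ← derivative_map, hMEA, hNEA, Finset.mem_filter, hTmem]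
      refine and_congr_right fun hα => ?_
      have h1 := hder0 α ((hTmem α).2 hα)
      simp only [eval_sub, eval_mul, eval_C, hc]
      rw [div_eq_iff h1, sub_eq_zero]
      rfl
    have hGfac := eq_C_mul_prod_roots (hsplit.of_dvd hMA0 hGM)
      (Multiset.nodup_of_le (roots.le_of_dvd hMA0 hGM) hnodup)
    rw [hroots] at hGfac
    refine ⟨C G.leadingCoeff⁻¹ * G, ?_⟩
    have hG1 : aeval x G = aeval x (G.map (ι : E →+* A)) := by
      rw [aeval_def, aeval_def, eval₂_map]
      rfl
    have hlG : algebraMap E U G.leadingCoeff =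
        algebraMap A U (G.map (ι : E →+* A)).leadingCoeff := by
      rw [leadingCoeff_map]; rfl
    have hlG0 : algebraMap A U (G.map (ι : E →+* A)).leadingCoeff ≠ 0 :=
      (_root_.map_ne_zero _).2 (leadingCoeff_ne_zero.2 hG0)
    rw [map_mul, aeval_C, map_inv₀, hlG, hG1]
    have hGx := congrArg (aeval x) hGfac
    rw [map_mul, aeval_C] at hGx
    rw [hGx, inv_mul_cancel_left₀ hlG0]
    simp

open Classical in
/-- Integration of a rational function: a rational part `b`, and simple fractions with the residues
`c α` at the poles `α ∈ T`. The last condition says that the logarithms of the `x - α` with the same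
residue `γ` combine to the logarithm of a polynomial over `F(γ)`. -/
theorem exists_integral [CharZero U] {F : Type*} [Field F] [Algebra F U] {D : Derivation ℤ U U}
    {x : U} (hF : ∀ a : F, D (algebraMap F U a) = 0) (hx : D x = 1)
    (hs : ∀ M : F[X], (M.map (algebraMap F U)).Splits)
    {f : U} (hf : f ∈ IntermediateField.adjoin F {x}) :
    ∃ b ∈ IntermediateField.adjoin F {x},
      ∃ (T : Finset (algebraicClosure F U)) (c : algebraicClosure F U → algebraicClosure F U),
      f = D b + ∑ α ∈ T, algebraMap _ U (c α) / (x - algebraMap _ U α) ∧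
      ∀ γ, ∃ P : (IntermediateField.adjoin F {algebraMap _ U γ})[X],
        ∏ α ∈ T with c α = γ, (x - algebraMap _ U α) = aeval x P := by
  obtain ⟨N, M, -, hM, rfl⟩ := exists_coprime_of_mem_adjoin hf
  obtain ⟨b, hb, N', M', hM', hd, h⟩ := hermite_reduction hF hx N M hM
  obtain ⟨T, c, h1, h2⟩ := exists_residues hF hx hM' hd (hs M')
  exact ⟨b, hb, T, c, by rw [h, h1], h2⟩

/-! ### Integrals depending on parameters -/

theorem adjoin_le_adjoin_algebraicClosure {F : Type*} [Field F] [Algebra F U] {x f : U}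
    (hf : f ∈ IntermediateField.adjoin F {x}) :
    f ∈ IntermediateField.adjoin (algebraicClosure F U) {x} := by
  obtain ⟨P, Q, rfl⟩ := (IntermediateField.mem_adjoin_simple_iff F f).1 hf
  rw [← aeval_map_algebraMap (algebraicClosure F U) x P,
    ← aeval_map_algebraMap (algebraicClosure F U) x Q]
  exact aeval_div_mem_adjoin _ _

theorem derivation_mem_adjoin {F : Subfield U} {δ : Derivation ℤ U U} {x f : U}
    (hδF : ∀ a ∈ F, δ a ∈ F) (hδx : δ x = 0) (hf : f ∈ IntermediateField.adjoin F {x}) :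
    δ f ∈ IntermediateField.adjoin F {x} := by
  obtain ⟨P, Q, rfl⟩ := (IntermediateField.mem_adjoin_simple_iff F f).1 hf
  have h : ∀ P : F[X], aeval x P ∈ IntermediateField.adjoin F {x} := fun P => by
    simpa using aeval_div_mem_adjoin (x := x) P 1
  have h' : ∀ P : F[X], δ (aeval x P) ∈ IntermediateField.adjoin F {x} := fun P => by
    obtain ⟨e, he, h⟩ := derivation_aeval_of_mem hδF x P
    rw [h, hδx, mul_zero, add_zero]
    exact he
  rw [Derivation.leibniz_div]
  simp only [smul_eq_mul]
  exact mul_mem (pow_mem (inv_mem (h Q)) 2)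
    (sub_mem (mul_mem (h Q) (h' P)) (mul_mem (h P) (h' Q)))

/-- The heart of the elimination of a variable `x`. The functions `f l` are integrated with respect
to `x`, by `b l + ∑ α, c l α * log (x - α)`, and `∑ l, δ l (f l)` is the derivative of the rational
function `β`. Since it then has no residues, the logarithms cancel in the sum of the derivatives
`δ l` of the integrals; its difference with `β` is independent of `x`, and comparing
polynomial parts shows that it is in the ground field, not only in its algebraic closure. -/
theorem sub_sum_derivation_integral_mem [CharZero U] {F : Subfield U} {D : Derivation ℤ U U}
    {x : U}
    (hF : ∀ a ∈ F, D a = 0) (hx : D x = 1) {Λ : Type*} (s : Finset Λ)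
    (δ : Λ → Derivation ℤ U U) (hcomm : ∀ l u, D (δ l u) = δ l (D u))
    (hδF : ∀ l, ∀ a ∈ F, δ l a ∈ F) (hδx : ∀ l, δ l x = 0)
    (T : Finset (algebraicClosure F U)) (lg : algebraicClosure F U → U)
    (hlg : ∀ α ∈ T, ∀ l, δ l (lg α) =
      δ l (x - algebraMap _ U α) / (x - algebraMap _ U α))
    (f b : Λ → U) (c : Λ → algebraicClosure F U → algebraicClosure F U)
    (hb : ∀ l, b l ∈ IntermediateField.adjoin F {x})
    (hf : ∀ l, f l = D (b l) + ∑ α ∈ T, algebraMap _ U (c l α) / (x - algebraMap _ U α))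
    {β : U} (hβ : β ∈ IntermediateField.adjoin F {x}) (hDβ : D β = ∑ l ∈ s, δ l (f l)) :
    β - ∑ l ∈ s, δ l (b l + ∑ α ∈ T, algebraMap _ U (c l α) * lg α) ∈ F := by
  classical
  have hF' : ∀ a : F, D (algebraMap F U a) = 0 := fun a => hF a a.2
  have hA : ∀ a : algebraicClosure F U, D (algebraMap _ U a) = 0 := fun a =>
    derivation_eq_zero_of_isAlgebraic hF' (mem_algebraicClosure_iff.1 a.2)
  have hδA : ∀ l, ∀ a : algebraicClosure F U, δ l (algebraMap _ U a) ∈ algebraicClosure F U :=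
    fun l a => mem_algebraicClosure_iff.2 (derivation_mem_algebraicClosure (hδF l)
      (mem_algebraicClosure_iff.1 a.2))
  have hne : ∀ α : algebraicClosure F U, x - algebraMap _ U α ≠ 0 := fun α => by
    simpa using aeval_ne_zero hA hx (X_sub_C_ne_zero α)
  set dA : Λ → algebraicClosure F U → algebraicClosure F U :=
    fun l a => ⟨δ l (algebraMap _ U a), hδA l a⟩ with hdA
  have hdA' : ∀ l a, algebraMap _ U (dA l a) = δ l (algebraMap _ U a) := fun l a => rfl
  -- in the sum of the `δ l` of the integrals, `e α` is the coefficient of `log (x - α)`, and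
  -- `g α` that of `1 / (x - α)`
  set e : algebraicClosure F U → algebraicClosure F U := fun α => ∑ l ∈ s, dA l (c l α) with he
  set g : algebraicClosure F U → algebraicClosure F U := fun α => -∑ l ∈ s, c l α * dA l α with hg
  have hbs : ∑ l ∈ s, δ l (b l) ∈ IntermediateField.adjoin F {x} :=
    sum_mem fun l _ => derivation_mem_adjoin (hδF l) (hδx l) (hb l)
  have hinv : ∀ a α : algebraicClosure F U, D (algebraMap _ U a / (x - algebraMap _ U α)) =
      -algebraMap _ U a / (x - algebraMap _ U α) ^ 2 := fun a α => by
    have := hne α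
    rw [Derivation.leibniz_div, map_sub, hA, hA, hx]
    simp only [smul_eq_mul]
    field_simp
    ring
  have hδinv : ∀ l, ∀ a α : algebraicClosure F U, δ l (algebraMap _ U a / (x - algebraMap _ U α)) =
      algebraMap _ U (dA l a) / (x - algebraMap _ U α) +
        algebraMap _ U (a * dA l α) / (x - algebraMap _ U α) ^ 2 := fun l a α => by
    have := hne α
    rw [Derivation.leibniz_div, map_sub, hδx, map_mul, hdA', hdA']
    simp only [smul_eq_mul]
    field_simp
    ring
  set R := β - ∑ l ∈ s, δ l (b l) - ∑ α ∈ T, algebraMap _ U (g α) / (x - algebraMap _ U α) with hR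
  have hsimple : ∀ g : algebraicClosure F U → algebraicClosure F U,
      ∑ α ∈ T, algebraMap _ U (g α) / (x - algebraMap _ U α) ∈
        IntermediateField.adjoin (algebraicClosure F U) {x} := fun g => by
    rw [sum_simple_fractions T g fun α _ => hne α]
    exact aeval_div_mem_adjoin _ _
  have hRmem : R ∈ IntermediateField.adjoin (algebraicClosure F U) {x} :=
    sub_mem (adjoin_le_adjoin_algebraicClosure (sub_mem hβ hbs)) (hsimple g)
  have hDR : ∑ α ∈ T, algebraMap _ U (e α) / (x - algebraMap _ U α) = D R := by
    have h1 : ∀ l, δ l (f l) = D (δ l (b l)) + (∑ α ∈ T, algebraMap _ U (dA l (c l α)) /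
        (x - algebraMap _ U α) + ∑ α ∈ T, algebraMap _ U (c l α * dA l α) /
        (x - algebraMap _ U α) ^ 2) := fun l => by
      rw [hf, map_add, hcomm, map_sum, ← Finset.sum_add_distrib]
      congr 1
      exact Finset.sum_congr rfl fun α _ => hδinv l _ _
    have h2 : ∑ l ∈ s, ∑ α ∈ T, algebraMap _ U (dA l (c l α)) / (x - algebraMap _ U α) =
        ∑ α ∈ T, algebraMap _ U (e α) / (x - algebraMap _ U α) := by
      rw [Finset.sum_comm]
      refine Finset.sum_congr rfl fun α _ => ?_
      rw [he, map_sum, Finset.sum_div]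
    have h3 : ∑ l ∈ s, ∑ α ∈ T, algebraMap _ U (c l α * dA l α) / (x - algebraMap _ U α) ^ 2 =
        ∑ α ∈ T, -algebraMap _ U (g α) / (x - algebraMap _ U α) ^ 2 := by
      rw [Finset.sum_comm]
      refine Finset.sum_congr rfl fun α _ => ?_
      rw [hg, map_neg, neg_neg, map_sum, Finset.sum_div]
    rw [hR, map_sub, map_sub, hDβ, Finset.sum_congr rfl fun l _ => h1 l, Finset.sum_add_distrib,
      Finset.sum_add_distrib, h2, h3, map_sum, map_sum,
      Finset.sum_congr rfl fun α _ => hinv (g α) α]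
    ring
  -- `∑ α, e α / (x - α)` is the derivative of `R`, so the logarithms cancel and `R` is a constant
  have he0 := residue_eq_zero hA hx T e hRmem hDR
  have hDR0 : D R = 0 := by
    rw [← hDR]
    exact Finset.sum_eq_zero fun α hα => by rw [he0 α hα, map_zero, zero_div]
  obtain ⟨a, ha⟩ := mem_range_of_derivation_eq_zero hA hx hRmem hDR0
  -- `R` differs from the element `β - ∑ l, δ l (b l)` of `F(x)` by proper fractions only
  obtain ⟨a', ha'⟩ := mem_range_of_eq_add_proper hA hx (a := a) (sub_mem hβ hbs)
    (degree_sum_simple_fractions_lt T fun α => -g α) (by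
      rw [← sum_simple_fractions T _ fun α _ => hne α, ← ha, hR, sub_eq_add_neg,
        ← Finset.sum_neg_distrib]
      congr 1
      refine Finset.sum_congr rfl fun α _ => ?_
      generalize g α = y
      rw [map_neg, neg_div])
  have hint : ∑ l ∈ s, δ l (b l + ∑ α ∈ T, algebraMap _ U (c l α) * lg α) =
      ∑ l ∈ s, δ l (b l) + ∑ α ∈ T, algebraMap _ U (g α) / (x - algebraMap _ U α) := by
    have h1 : ∀ l, δ l (b l + ∑ α ∈ T, algebraMap _ U (c l α) * lg α) =
        δ l (b l) + ∑ α ∈ T, (algebraMap _ U (dA l (c l α)) * lg α -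
          algebraMap _ U (c l α * dA l α) / (x - algebraMap _ U α)) := fun l => by
      rw [map_add, map_sum]
      congr 1
      refine Finset.sum_congr rfl fun α hα => ?_
      rw [Derivation.leibniz, hlg α hα, map_sub, hδx, map_mul, hdA', hdA']
      simp only [smul_eq_mul]
      ring
    rw [Finset.sum_congr rfl fun l _ => h1 l, Finset.sum_add_distrib, Finset.sum_comm]
    congr 1
    refine Finset.sum_congr rfl fun α hα => ?_
    have h2 : ∑ l ∈ s, algebraMap _ U (dA l (c l α)) * lg α = 0 := by
      rw [← Finset.sum_mul, ← map_sum]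
      have := he0 α hα
      rw [he] at this
      simp only at this
      rw [this, map_zero, zero_mul]
    rw [Finset.sum_sub_distrib, h2, zero_sub, ← Finset.sum_div, ← map_sum, hg, map_neg, neg_div]
  rw [hint, ← sub_sub, ← hR, ha, ha']
  exact a'.2

end Integration

/-! ### Extension of derivations -/

section Extensions

/-- Derivations extend along formally étale algebras, because `B ⊗ Ω[A⁄ℤ] ≃ Ω[B⁄ℤ]`. -/
theorem exists_derivation_of_formallyEtale {A B : Type*} [CommRing A] [CommRing B] [Algebra A B]
    [Algebra.FormallyEtale A B] (d : Derivation ℤ A B) :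
    ∃ D : Derivation ℤ B B, ∀ a, D (algebraMap A B a) = d a := by
  let g : TensorProduct A B (Ω[A⁄ℤ]) →ₗ[B] B := d.liftKaehlerDifferential.liftBaseChange B
  refine ⟨(g ∘ₗ
    (KaehlerDifferential.tensorKaehlerEquivOfFormallyEtale ℤ A B).symm.toLinearMap).compDer
    (KaehlerDifferential.D ℤ B), fun a => ?_⟩
  change g ((KaehlerDifferential.tensorKaehlerEquivOfFormallyEtale ℤ A B).symm
    (KaehlerDifferential.D ℤ B (algebraMap A B a))) = _
  rw [KaehlerDifferential.tensorKaehlerEquivOfFormallyEtale_symm_D_algebraMap]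
  simp [g]

theorem exists_derivation_extending {A B : Type*} [CommRing A] [CommRing B] [Algebra A B]
    [Algebra.FormallyEtale A B] (d : Derivation ℤ A A) :
    ∃ D : Derivation ℤ B B, ∀ a, D (algebraMap A B a) = algebraMap A B (d a) :=
  exists_derivation_of_formallyEtale ((Algebra.linearMap A B).compDer d)

/-- The relation that makes the extended derivations commute on an adjoined logarithm. -/
theorem derivation_logDeriv_comm {B : Type*} [Field B] {D D' : Derivation ℤ B B}
    (h : ∀ b, D (D' b) = D' (D b)) (b : B) : D (D' b / b) = D' (D b / b) := by
  rw [Derivation.leibniz_div, Derivation.leibniz_div, h]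
  simp only [smul_eq_mul]
  ring

theorem derivation_eq_zero_of_formallyUnramified {A B : Type*} [CommRing A] [CommRing B]
    [Algebra A B] [Algebra.FormallyUnramified A B] {D : Derivation ℤ B B}
    (hD : ∀ a, D (algebraMap A B a) = 0) (b : B) : D b = 0 := by
  let D' : Derivation A B B := Derivation.mk'
    { toFun := D
      map_add' := map_add D
      map_smul' := fun a b => by
        simp [Algebra.smul_def, hD] } fun a b => D.leibniz a b
  have : D' b = D'.liftKaehlerDifferential (KaehlerDifferential.D A B b) :=
    (D'.liftKaehlerDifferential_comp_D b).symm
  change D' b = 0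
  rw [this, Subsingleton.elim (KaehlerDifferential.D A B b) 0, map_zero]

theorem derivation_comm_of_formallyUnramified {A B : Type*} [CommRing A] [CommRing B]
    [Algebra A B] [Algebra.FormallyUnramified A B] {D D' : Derivation ℤ B B}
    (h : ∀ a, D (D' (algebraMap A B a)) = D' (D (algebraMap A B a))) (b : B) :
    D (D' b) = D' (D b) := by
  have := derivation_eq_zero_of_formallyUnramified (A := A) (D := ⁅D, D'⁆)
    (fun a => by rw [Derivation.commutator_apply, h, sub_self]) b
  rwa [Derivation.commutator_apply, sub_eq_zero] at this

/-- A derivation of the coefficients extends to polynomials, with prescribed values at the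
variables. A derivation is the second component of a ring homomorphism to the dual numbers. -/
theorem exists_derivation_mvPolynomial {R σ : Type*} [CommRing R] (d : Derivation ℤ R R)
    (f : σ → MvPolynomial σ R) : ∃ D : Derivation ℤ (MvPolynomial σ R) (MvPolynomial σ R),
      (∀ a, D (MvPolynomial.C a) = MvPolynomial.C (d a)) ∧ ∀ i, D (MvPolynomial.X i) = f i := by
  let ι : R →+* TrivSqZeroExt (MvPolynomial σ R) (MvPolynomial σ R) :=
    { toFun := fun a => .inl (MvPolynomial.C a) + .inr (MvPolynomial.C (d a))
      map_one' := by apply TrivSqZeroExt.ext <;> simp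
      map_zero' := by apply TrivSqZeroExt.ext <;> simp
      map_add' := fun a b => by apply TrivSqZeroExt.ext <;> simp
      map_mul' := fun a b => by apply TrivSqZeroExt.ext <;> simp [mul_comm] }
  let φ : MvPolynomial σ R →+* TrivSqZeroExt (MvPolynomial σ R) (MvPolynomial σ R) :=
    MvPolynomial.eval₂Hom ι fun i => .inl (MvPolynomial.X i) + .inr (f i)
  have hC : ∀ a, φ (MvPolynomial.C a) = .inl (MvPolynomial.C a) + .inr (MvPolynomial.C (d a)) :=
    fun a => MvPolynomial.eval₂Hom_C _ _ _
  have hX : ∀ i, φ (MvPolynomial.X i) = .inl (MvPolynomial.X i) + .inr (f i) := fun i =>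
    MvPolynomial.eval₂Hom_X' _ _ _
  have hfst : ∀ p, (φ p).fst = p := fun p => by
    have : ((TrivSqZeroExt.fstHom (MvPolynomial σ R) (MvPolynomial σ R)
        (MvPolynomial σ R)).toRingHom.comp φ) = RingHom.id _ := by
      apply MvPolynomial.ringHom_ext
      · intro a
        change (φ (MvPolynomial.C a)).fst = _
        rw [hC]; simp
      · intro i
        change (φ (MvPolynomial.X i)).fst = _
        rw [hX]; simp
    exact congrArg (fun g : _ →+* _ => g p) this
  refine ⟨Derivation.mk' (AddMonoidHom.toIntLinearMap
    { toFun := fun p => (φ p).snd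
      map_zero' := by simp
      map_add' := fun p q => by simp }) fun p q => ?_, fun a => ?_, fun i => ?_⟩
  · change (φ (p * q)).snd = p • (φ q).snd + q • (φ p).snd
    rw [map_mul, TrivSqZeroExt.snd_mul, hfst, hfst]
    simp [mul_comm]
  · change (φ _).snd = _
    rw [hC]; simp
  · change (φ _).snd = _
    rw [hX]; simp

theorem derivation_mvPolynomial_comm {R σ : Type*} [CommRing R]
    {D D' : Derivation ℤ (MvPolynomial σ R) (MvPolynomial σ R)}
    (hC : ∀ a, D (D' (MvPolynomial.C a)) = D' (D (MvPolynomial.C a)))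
    (hX : ∀ i, D (D' (MvPolynomial.X i)) = D' (D (MvPolynomial.X i))) (p : MvPolynomial σ R) :
    D (D' p) = D' (D p) := by
  rw [← sub_eq_zero, ← Derivation.commutator_apply]
  induction p using MvPolynomial.induction_on with
  | C a => rw [Derivation.commutator_apply, hC, sub_self]
  | add p q hp hq => rw [map_add, hp, hq, add_zero]
  | mul_X p i hp =>
    rw [Derivation.leibniz, hp, Derivation.commutator_apply, hX, sub_self, smul_zero, smul_zero,
      add_zero]

/-! ### A differential field with logarithms -/

universe u

/-- The algebraic closure of `k(x_1, …, x_m)`, with an indeterminate `X b` adjoined for each element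
`b`, to serve as its logarithm. -/
abbrev LogRing (k : Type u) [Field k] (m : ℕ) : Type u :=
  MvPolynomial (AlgebraicClosure (RatField k m)) (AlgebraicClosure (RatField k m))

/-- The fraction field of `LogRing k m`. -/
abbrev LogField (k : Type u) [Field k] (m : ℕ) : Type u :=
  FractionRing (LogRing k m)

/-- The partial derivatives extend to commuting derivations of `LogField k m` for which `X b` is a
logarithm of `b ≠ 0`. They extend uniquely to the algebraic closure and to fractions, and to the
polynomial ring by `∂ (X b) = ∂ b / b`. -/
theorem exists_partialDerivations_logField (k : Type u) [Field k] [CharZero k] (m : ℕ) :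
    ∃ ε : PartialDerivations k m (LogField k m), ∀ (b : AlgebraicClosure (RatField k m)) i,
      algebraMap (LogRing k m) (LogField k m) (MvPolynomial.C b) *
        ε.D i (algebraMap (LogRing k m) (LogField k m) (MvPolynomial.X b)) =
      ε.D i (algebraMap (LogRing k m) (LogField k m) (MvPolynomial.C b)) := by
  let Kb := AlgebraicClosure (RatField k m)
  let R := MvPolynomial (Fin m) k
  let M := LogRing k m
  have : Algebra.FormallyEtale R (RatField k m) :=
    Algebra.FormallyEtale.of_isLocalization (nonZeroDivisors R)
  have : Algebra.FormallyEtale (RatField k m) Kb := Algebra.FormallyEtale.of_isSeparable _ _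
  have : Algebra.FormallyEtale R Kb := Algebra.FormallyEtale.comp R (RatField k m) Kb
  have : Algebra.FormallyEtale M (LogField k m) :=
    Algebra.FormallyEtale.of_isLocalization (nonZeroDivisors M)
  choose d hd using fun i : Fin m => exists_derivation_of_formallyEtale (A := R) (B := Kb)
    ((Algebra.linearMap R Kb).compDer (Derivation.restrictScalars ℤ (MvPolynomial.pderiv i)))
  replace hd : ∀ i (P : R), d i (algebraMap R Kb P) =
    algebraMap R Kb (MvPolynomial.pderiv i P) := hd
  have hdcomm : ∀ i j b, d i (d j b) = d j (d i b) := fun i j =>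
    derivation_comm_of_formallyUnramified (A := R) fun P => by
      rw [hd, hd, hd, hd]
      congr 1
      have := derivation_mvPolynomial_comm
        (D := (MvPolynomial.pderiv i : Derivation k R R).restrictScalars ℤ)
        (D' := (MvPolynomial.pderiv j : Derivation k R R).restrictScalars ℤ)
        (fun a => by simp)
        (fun l => by classical simp [MvPolynomial.pderiv_X, Pi.single_apply, apply_ite]) P
      exact this
  choose e heC heX using fun i : Fin m => exists_derivation_mvPolynomial (d i)
    fun b : Kb => MvPolynomial.C (d i b / b)
  have hecomm : ∀ i j p, e i (e j p) = e j (e i p) := fun i j =>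
    derivation_mvPolynomial_comm (fun a => by rw [heC, heC, heC, heC, hdcomm]) fun b => by
      rw [heX, heX, heC, heC]
      rw [derivation_logDeriv_comm (hdcomm i j)]
  choose D hD using fun i : Fin m => exists_derivation_extending (A := M) (B := LogField k m) (e i)
  replace hD : ∀ i (p : MvPolynomial Kb Kb), D i (algebraMap M (LogField k m) p) =
    algebraMap M (LogField k m) (e i p) := hD
  have hmap : ∀ P : R, algebraMap (RatField k m) (LogField k m) (algebraMap R (RatField k m) P) =
      algebraMap M (LogField k m) (MvPolynomial.C (algebraMap R Kb P)) := fun P => by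
    rw [IsScalarTower.algebraMap_apply (RatField k m) M (LogField k m),
      IsScalarTower.algebraMap_apply R (RatField k m) Kb]
    rfl
  refine ⟨⟨D, fun i j => derivation_comm_of_formallyUnramified (A := M) fun p => ?_,
    fun i P => ?_⟩, fun b i => ?_⟩
  · rw [hD, hD, hD, hD, hecomm]
  · rw [hmap, hmap, hD, heC, hd]
  · change _ * D i _ = D i _
    rw [hD, hD, heX, heC, ← map_mul, ← map_mul]
    by_cases hb : b = 0
    · simp [hb]
    · rw [mul_div_cancel₀ _ hb]

end Extensions

/-! ### Roots and logarithms in a universal extension -/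

section Universal

open Polynomial

universe u v

variable {k : Type u} [Field k] [CharZero k] {m : ℕ} {U : Type v} [Field U]
  [Algebra (RatField k m) U] {δ : PartialDerivations k m U}

theorem map_sub_C_mul_prod_X_sub_C {K V E ι : Type*} [Field K] [CommRing V] [CommRing E]
    [Algebra K V] [Algebra K E] [Fintype ι] (θ : V →ₐ[K] E) (P : K[X]) (a : ι → V) :
    (P.map (algebraMap K V) - C (algebraMap K V P.leadingCoeff) * ∏ i, (X - C (a i))).map
      θ.toRingHom = P.map (algebraMap K E) -
        C (algebraMap K E P.leadingCoeff) * ∏ i, (X - C (θ (a i))) := by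
  simp only [Polynomial.map_sub, Polynomial.map_mul, Polynomial.map_prod, Polynomial.map_map,
    map_X, map_C, AlgHom.toRingHom_eq_coe, AlgHom.comp_algebraMap, RingHom.coe_coe, AlgHom.commutes]

/-- In a universal extension, every polynomial `P` over `k(x_1, …, x_m)` splits, and its nonzero
roots have logarithms: the relations between the roots of `P` and their logarithms in `LogField k m`
form a system of differential equations. -/
theorem splits_and_exists_log (hU : δ.IsUniversal) (P : (RatField k m)[X]) :
    (P.map (algebraMap (RatField k m) U)).Splits ∧
      ∀ b : U, aeval b P = 0 → P ≠ 0 → b ≠ 0 → ∃ l, δ.IsLog l b := by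
  obtain ⟨ε, hε⟩ := exists_partialDerivations_logField k m
  set Kb := AlgebraicClosure (RatField k m)
  set L := LogField k m
  have hsp : (P.map (algebraMap (RatField k m) Kb)).Splits := IsAlgClosed.splits _
  set zs := (P.map (algebraMap (RatField k m) Kb)).roots.toList with hzs
  set n := zs.length with hn
  let j : Kb → L := fun b => algebraMap (MvPolynomial Kb Kb) L (MvPolynomial.C b)
  let z : Fin n → L := fun i => j (zs.get i)
  let y : Fin n → L := fun i => algebraMap (MvPolynomial Kb Kb) L (MvPolynomial.X (zs.get i))
  have hfac : P.map (algebraMap (RatField k m) L) =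
      C (algebraMap (RatField k m) L P.leadingCoeff) * ∏ i, (X - C (z i)) := by
    have h1 := hsp.eq_prod_roots
    rw [← Multiset.coe_toList (P.map (algebraMap (RatField k m) Kb)).roots, ← hzs,
      Multiset.map_coe, Multiset.prod_coe, leadingCoeff_map] at h1
    have h2 : (zs.map fun a => X - C a).prod = ∏ i : Fin n, (X - C (zs.get i)) := by
      rw [← List.prod_ofFn]
      congr 1
      conv_lhs => rw [← List.ofFn_get zs, List.map_ofFn]
      rfl
    rw [h2] at h1
    let jr : Kb →+* L := (algebraMap (MvPolynomial Kb Kb) L).comp MvPolynomial.C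
    have h3 : jr.comp (algebraMap (RatField k m) Kb) = algebraMap (RatField k m) L := by
      rw [IsScalarTower.algebraMap_eq (RatField k m) (MvPolynomial Kb Kb) L]
      rfl
    have h5 : jr (algebraMap (RatField k m) Kb P.leadingCoeff) =
        algebraMap (RatField k m) L P.leadingCoeff := RingHom.congr_fun h3 _
    have h4 := congrArg (Polynomial.map jr) h1
    rw [Polynomial.map_map, h3, Polynomial.map_mul, Polynomial.map_prod, map_C,
      h5] at h4
    rw [h4]
    congr 1
    refine Finset.prod_congr rfl fun i _ => ?_
    rw [Polynomial.map_sub, map_X, map_C]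
    rfl
  -- the unknowns are the roots `z`, with multiplicities, and their logarithms `y`; the system
  -- consists of all the differential equations that they satisfy in `LogField k m`
  obtain ⟨w, hw⟩ := hU (n + n) {Q | ε.eval (Fin.append z y) Q = 0} L ε
    ⟨Fin.append z y, fun Q hQ => hQ⟩
  let V := MvPolynomial (Fin (n + n) × List (Fin m)) (RatField k m)
  let z' : Fin n → U := fun i => w (Fin.castAdd n i)
  let y' : Fin n → U := fun i => w (Fin.natAdd n i)
  have hfac' : P.map (algebraMap (RatField k m) U) =
      C (algebraMap (RatField k m) U P.leadingCoeff) * ∏ i, (X - C (z' i)) := by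
    -- the coefficients of `Φ` are the equations by which the `z i` are the roots of `P`
    let Φ : V[X] := P.map (algebraMap (RatField k m) V) -
      C (algebraMap (RatField k m) V P.leadingCoeff) *
        ∏ i : Fin n, (X - C (MvPolynomial.X (Fin.castAdd n i, [])))
    have hΦ : Φ.map (MvPolynomial.aeval fun q : Fin (n + n) × List (Fin m) =>
        δ.iter q.2 (w q.1) : V →ₐ[RatField k m] U).toRingHom = 0 := by
      ext l
      rw [coeff_map, coeff_zero]
      refine hw (Φ.coeff l) ?_
      have := map_sub_C_mul_prod_X_sub_C (MvPolynomial.aeval fun q : Fin (n + n) × List (Fin m) =>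
        ε.iter q.2 (Fin.append z y q.1) : V →ₐ[RatField k m] L) P
        fun i : Fin n => MvPolynomial.X (Fin.castAdd n i, [])
      simp only [MvPolynomial.aeval_X, Fin.append_left, PartialDerivations.iter,
        List.foldr_nil] at this
      rw [hfac, sub_self] at this
      have := congrArg (fun R : L[X] => Polynomial.coeff R l) this
      simp only [coeff_map, coeff_zero] at this
      exact this
    rw [map_sub_C_mul_prod_X_sub_C, sub_eq_zero] at hΦ
    simpa [PartialDerivations.iter] using hΦ
  refine ⟨?_, fun b hb hP hb0 => ?_⟩
  · rw [hfac']
    exact (Splits.C _).mul (Splits.prod fun i _ => Splits.X_sub_C _)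
  · have hb' : ∏ i, (b - z' i) = 0 := by
      have := congrArg (eval b) hfac'
      rw [eval_map, ← aeval_def, hb, eval_mul, eval_C, eval_prod] at this
      simpa using (mul_eq_zero.1 this.symm).resolve_left
        ((_root_.map_ne_zero _).2 (leadingCoeff_ne_zero.2 hP))
    obtain ⟨i, -, hi⟩ := Finset.prod_eq_zero_iff.1 hb'
    rw [sub_eq_zero] at hi
    refine ⟨y' i, hb0, fun t => ?_⟩
    -- the equation `z i * ∂_t (y i) = ∂_t (z i)`
    have h1 : δ.eval w (MvPolynomial.X (Fin.castAdd n i, []) *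
        MvPolynomial.X (Fin.natAdd n i, [t]) - MvPolynomial.X (Fin.castAdd n i, [t])) = 0 := by
      apply hw
      simp only [Set.mem_ofPred_eq, PartialDerivations.eval, PartialDerivations.iter, map_sub,
        map_mul, MvPolynomial.aeval_X, Fin.append_left, Fin.append_right, List.foldr_nil,
        List.foldr_cons]
      rw [sub_eq_zero]
      exact hε _ _
    simp only [PartialDerivations.eval, PartialDerivations.iter, map_sub, map_mul,
        MvPolynomial.aeval_X, List.foldr_nil, List.foldr_cons] at h1
    rw [eq_div_iff hb0, mul_comm, hi]
    exact sub_eq_zero.1 h1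

end Universal

section Differential

open Polynomial

universe u v

variable {k : Type u} [Field k] {m : ℕ} {U : Type v} [Field U]
  [Algebra (RatField k m) U] {δ : PartialDerivations k m U}

/-! ### A multiplicative choice of logarithms -/

/-- Logarithms can be chosen so that the logarithm of a product is the sum of the logarithms: choose
them in a complement of the `ℚ`-vector space of constants. -/
theorem exists_multiplicative_log [CharZero U] (δ : PartialDerivations k m U) :
    ∃ log : U → U, (∀ b l, δ.IsLog l b → δ.IsLog (log b) b) ∧
      ∀ a b l l', δ.IsLog l a → δ.IsLog l' b → log (a * b) = log a + log b := by
  classical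
  -- the space of constants
  let N : Submodule ℚ U :=
    { carrier := {c | ∀ i, δ.D i c = 0}
      add_mem' := fun ha hb i => by rw [map_add, ha i, hb i, add_zero]
      zero_mem' := fun i => map_zero _
      smul_mem' := fun q c hc i => by
        rw [map_rat_smul (δ.D i), hc i, smul_zero] }
  obtain ⟨N', hN'⟩ := N.exists_isCompl
  have hex : ∀ b l, δ.IsLog l b → ∃ l' ∈ N', δ.IsLog l' b := fun b l hl => by
    obtain ⟨c, hc, l', hl', h⟩ := Submodule.mem_sup.1
      (hN'.sup_eq_top ▸ Submodule.mem_top : l ∈ N ⊔ N')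
    refine ⟨l', hl', hl.1, fun i => ?_⟩
    rw [← hl.2 i, ← h, map_add, hc i, zero_add]
  have huniq : ∀ b l l', l ∈ N' → l' ∈ N' → δ.IsLog l b → δ.IsLog l' b → l = l' :=
    fun b l l' h h' hl hl' => by
      refine sub_eq_zero.1 ((Submodule.mem_bot ℚ).1 (hN'.inf_eq_bot ▸
        Submodule.mem_inf.2 ⟨fun i => ?_, N'.sub_mem h h'⟩))
      rw [map_sub, hl.2 i, hl'.2 i, sub_self]
  let log : U → U := fun b => if h : ∃ l ∈ N', δ.IsLog l b then h.choose else 0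
  have hlog : ∀ b l, δ.IsLog l b → log b ∈ N' ∧ δ.IsLog (log b) b := fun b l hl => by
    have h := hex b l hl
    simp only [log, dif_pos h]
    exact h.choose_spec
  refine ⟨log, fun b l hl => (hlog b l hl).2, fun a b l l' hl hl' => ?_⟩
  obtain ⟨ha, ha'⟩ := hlog a l hl
  obtain ⟨hb, hb'⟩ := hlog b l' hl'
  have hab : δ.IsLog (log a + log b) (a * b) := by
    refine ⟨mul_ne_zero ha'.1 hb'.1, fun i => ?_⟩
    have h1 := ha'.1
    have h2 := hb'.1
    rw [map_add, ha'.2, hb'.2, Derivation.leibniz]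
    simp only [smul_eq_mul]
    field_simp
    ring
  obtain ⟨h, h'⟩ := hlog _ _ hab
  exact huniq _ _ _ h (N'.add_mem ha hb) h' hab

theorem log_prod {log : U → U}
    (h1 : ∀ b l, δ.IsLog l b → δ.IsLog (log b) b)
    (h2 : ∀ a b l l', δ.IsLog l a → δ.IsLog l' b → log (a * b) = log a + log b)
    {ι : Type*} (s : Finset ι) (b : ι → U) (hb : ∀ i ∈ s, ∃ l, δ.IsLog l (b i)) :
    log (∏ i ∈ s, b i) = ∑ i ∈ s, log (b i) ∧ δ.IsLog (log (∏ i ∈ s, b i)) (∏ i ∈ s, b i) := by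
  classical
  have hone : δ.IsLog 0 1 := ⟨one_ne_zero, fun i => by simp⟩
  induction s using Finset.induction_on with
  | empty =>
    have : log (1 * 1) = log 1 + log 1 := h2 _ _ _ _ hone hone
    rw [mul_one, left_eq_add] at this
    exact ⟨by simpa using this, by simpa using h1 _ _ hone⟩
  | insert i s hi ih =>
    obtain ⟨e, hs⟩ := ih fun j hj => hb j (Finset.mem_insert_of_mem hj)
    obtain ⟨l, hl⟩ := hb i (Finset.mem_insert_self i s)
    have hab := h2 _ _ _ _ hl hs
    rw [Finset.prod_insert hi, Finset.sum_insert hi, ← e]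
    refine ⟨hab, h1 _ (log (b i) + log (∏ i ∈ s, b i))
      ⟨mul_ne_zero hl.1 hs.1, fun t => ?_⟩⟩
    have ha' := h1 _ _ hl
    have n1 := hl.1
    have n2 := hs.1
    rw [map_add, ha'.2, hs.2, Derivation.leibniz]
    simp only [smul_eq_mul]
    field_simp
    ring

/-! ### The fields `k(x_1, …, x_i)` -/

theorem firstVars_eq_closure (s : ℕ) : firstVars k m U s = Subfield.closure
    (Set.range (fun a : k => algebraMap (RatField k m) U
      (algebraMap (MvPolynomial (Fin m) k) (RatField k m) (MvPolynomial.C a))) ∪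
      {f | ∃ j : Fin m, (j : ℕ) < s ∧ f = var k U j}) := by
  rw [firstVars, IntermediateField.adjoin_toSubfield, RingHom.map_field_closure, Set.image_union,
    ← Set.range_comp]
  congr 2
  ext f
  constructor
  · rintro ⟨_, ⟨j, hj, rfl⟩, rfl⟩
    exact ⟨j, hj, rfl⟩
  · rintro ⟨j, hj, rfl⟩
    exact ⟨_, ⟨j, hj, rfl⟩, rfl⟩

theorem var_mem_firstVars {s : ℕ} {j : Fin m} (hj : (j : ℕ) < s) :
    var k U j ∈ firstVars k m U s := by
  rw [firstVars_eq_closure]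
  exact Subfield.subset_closure (Or.inr ⟨j, hj, rfl⟩)

theorem firstVars_mono {s t : ℕ} (h : s ≤ t) : firstVars k m U s ≤ firstVars k m U t := by
  rw [firstVars_eq_closure, firstVars_eq_closure]
  refine Subfield.closure_mono (Set.union_subset_union_right _ ?_)
  rintro _ ⟨j, hj, rfl⟩
  exact ⟨j, hj.trans_le h, rfl⟩

theorem firstVars_le_fieldRange (s : ℕ) :
    firstVars k m U s ≤ (algebraMap (RatField k m) U).fieldRange := by
  rintro _ ⟨a, -, rfl⟩
  exact ⟨a, rfl⟩

theorem fieldRange_le_firstVars :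
    (algebraMap (RatField k m) U).fieldRange ≤ firstVars k m U m := by
  have hpoly : ∀ P : MvPolynomial (Fin m) k,
      algebraMap (RatField k m) U (algebraMap _ (RatField k m) P) ∈ firstVars k m U m := fun P => by
    induction P using MvPolynomial.induction_on with
    | C a =>
      rw [firstVars_eq_closure]
      exact Subfield.subset_closure (Or.inl ⟨a, rfl⟩)
    | add p q hp hq => rw [map_add, map_add]; exact add_mem hp hq
    | mul_X p i hp => rw [map_mul, map_mul]; exact mul_mem hp (var_mem_firstVars i.2)
  rintro _ ⟨f, rfl⟩
  obtain ⟨P, Q, -, rfl⟩ := IsFractionRing.div_surjective (MvPolynomial (Fin m) k) f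
  rw [map_div₀]
  exact div_mem (hpoly P) (hpoly Q)

theorem D_var (t s : Fin m) : δ.D t (var k U s) = if t = s then 1 else 0 := by
  rw [var, δ.extends_pderiv, MvPolynomial.pderiv_X, Pi.single_apply]
  by_cases h : t = s
  · rw [if_pos h, if_pos h.symm, map_one, map_one]
  · rw [if_neg h, if_neg (Ne.symm h), map_zero, map_zero]

theorem D_const (t : Fin m) (a : k) : δ.D t (algebraMap (RatField k m) U
      (algebraMap (MvPolynomial (Fin m) k) (RatField k m) (MvPolynomial.C a))) = 0 := by
  rw [δ.extends_pderiv, MvPolynomial.pderiv_C, map_zero, map_zero]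

theorem derivation_mem_of_closure {D : Derivation ℤ U U} {S : Set U}
    (hS : ∀ a ∈ S, D a ∈ Subfield.closure S) {a : U} (ha : a ∈ Subfield.closure S) :
    D a ∈ Subfield.closure S := by
  induction ha using Subfield.closure_induction with
  | mem x hx => exact hS x hx
  | one => rw [Derivation.map_one_eq_zero]; exact zero_mem _
  | add x y _ _ hx hy => rw [map_add]; exact add_mem hx hy
  | neg x _ hx => rw [map_neg]; exact neg_mem hx
  | inv x hx' hx =>
    rw [Derivation.leibniz_inv, smul_eq_mul]
    exact mul_mem (neg_mem (pow_mem (inv_mem hx') 2)) hx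
  | mul x y hx' hy' hx hy =>
    rw [Derivation.leibniz]
    exact add_mem (mul_mem hx' hy) (mul_mem hy' hx)

theorem derivation_eq_zero_of_closure {D : Derivation ℤ U U} {S : Set U}
    (hS : ∀ a ∈ S, D a = 0) {a : U} (ha : a ∈ Subfield.closure S) : D a = 0 := by
  induction ha using Subfield.closure_induction with
  | mem x hx => exact hS x hx
  | one => exact Derivation.map_one_eq_zero _
  | add x y _ _ hx hy => rw [map_add, hx, hy, add_zero]
  | neg x _ hx => rw [map_neg, hx, neg_zero]
  | inv x _ hx => rw [Derivation.leibniz_inv, hx, smul_zero]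
  | mul x y _ _ hx hy => rw [Derivation.leibniz, hx, hy, smul_zero, smul_zero, add_zero]

theorem D_mem_firstVars (t : Fin m) (s : ℕ) {a : U} (ha : a ∈ firstVars k m U s) :
    δ.D t a ∈ firstVars k m U s := by
  rw [firstVars_eq_closure] at *
  refine derivation_mem_of_closure ?_ ha
  rintro _ (⟨a, rfl⟩ | ⟨j, -, rfl⟩)
  · rw [D_const]; exact zero_mem _
  · rw [D_var]; split_ifs
    · exact one_mem _
    · exact zero_mem _

theorem D_eq_zero_of_mem_firstVars {t : Fin m} {s : ℕ} (hts : s ≤ t) {a : U}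
    (ha : a ∈ firstVars k m U s) : δ.D t a = 0 := by
  rw [firstVars_eq_closure] at ha
  refine derivation_eq_zero_of_closure ?_ ha
  rintro _ (⟨a, rfl⟩ | ⟨j, hj, rfl⟩)
  · exact D_const t a
  · rw [D_var, if_neg]
    rintro rfl
    omega

theorem mem_firstVars_succ_iff {s : Fin m} {f : U} : f ∈ firstVars k m U (s + 1) ↔
    f ∈ IntermediateField.adjoin (firstVars k m U s) {var k U s} := by
  constructor
  · intro hf
    have hle : firstVars k m U (s + 1) ≤
        (IntermediateField.adjoin (firstVars k m U s) {var k U s}).toSubfield := by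
      rw [firstVars_eq_closure (s + 1), Subfield.closure_le]
      rintro _ (⟨a, rfl⟩ | ⟨j, hj, rfl⟩)
      · refine IntermediateField.algebraMap_mem _ (⟨_, ?_⟩ : firstVars k m U s)
        rw [firstVars_eq_closure]
        exact Subfield.subset_closure (Or.inl ⟨a, rfl⟩)
      · rcases Nat.lt_succ_iff_lt_or_eq.1 hj with h | h
        · exact IntermediateField.algebraMap_mem _ (⟨_, var_mem_firstVars h⟩ : firstVars k m U s)
        · rw [Fin.ext h]
          exact IntermediateField.mem_adjoin_simple_self _ _
    exact hle hf
  · intro hf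
    obtain ⟨P, Q, rfl⟩ := (IntermediateField.mem_adjoin_simple_iff _ f).1 hf
    have h : ∀ P : (firstVars k m U s)[X], aeval (var k U s) P ∈ firstVars k m U (s + 1) :=
      fun P => by
        rw [aeval_eq_sum_range]
        refine sum_mem fun i _ => ?_
        exact mul_mem (firstVars_mono (Nat.le_succ _) (P.coeff i).2)
          (pow_mem (var_mem_firstVars (Nat.lt_succ_self _)) _)
    exact div_mem (h P) (h Q)

/-! ### Integration with respect to one variable -/

theorem exists_map_eq_of_firstVars {s : ℕ} (M : (firstVars k m U s)[X]) :
    ∃ P : (RatField k m)[X],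
      P.map (algebraMap (RatField k m) U) = M.map (algebraMap (firstVars k m U s) U) := by
  have h : M.map (algebraMap (firstVars k m U s) U) ∈ lifts (algebraMap (RatField k m) U) := by
    rw [lifts_iff_coeff_lifts]
    intro n
    rw [coeff_map]
    exact firstVars_le_fieldRange s (M.coeff n).2
  exact (mem_lifts _).1 h

theorem isAlgebraic_ratField {s : ℕ} {a : U} (ha : IsAlgebraic (firstVars k m U s) a) :
    IsAlgebraic (RatField k m) a := by
  obtain ⟨M, hM, ha⟩ := ha
  obtain ⟨P, hP⟩ := exists_map_eq_of_firstVars M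
  refine ⟨P, fun h => hM ?_, ?_⟩
  · rw [h, Polynomial.map_zero, eq_comm,
      Polynomial.map_eq_zero_iff (algebraMap (firstVars k m U s) U).injective] at hP
    exact hP
  · rw [aeval_def, ← eval_map, hP, eval_map, ← aeval_def, ha]

theorem D_algebraMap_firstVars (s : Fin m) (a : firstVars k m U s) :
    δ.D s (algebraMap (firstVars k m U s) U a) = 0 :=
  D_eq_zero_of_mem_firstVars le_rfl a.2

theorem var_sub_ne_zero [CharZero U] {s : Fin m} (δ : PartialDerivations k m U)
    (α : algebraicClosure (firstVars k m U s) U) : var k U s - algebraMap _ U α ≠ 0 := by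
  intro h
  have h0 : δ.D s (algebraMap _ U α) = 0 := derivation_eq_zero_of_isAlgebraic
    (D_algebraMap_firstVars s) (mem_algebraicClosure_iff.1 α.2)
  have h1 : δ.D s (var k U s - algebraMap _ U α) = 1 := by
    rw [map_sub, D_var, if_pos rfl, h0, sub_zero]
  rw [h, map_zero] at h1
  exact zero_ne_one h1

variable [CharZero k]

theorem splits_of_firstVars (hU : δ.IsUniversal) {s : ℕ} (M : (firstVars k m U s)[X]) :
    (M.map (algebraMap (firstVars k m U s) U)).Splits := by
  obtain ⟨P, hP⟩ := exists_map_eq_of_firstVars M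
  exact hP ▸ (splits_and_exists_log hU P).1

theorem exists_log_var_sub (hU : δ.IsUniversal) {s : Fin m} {a : U}
    (ha : IsAlgebraic (firstVars k m U s) a) (hne : var k U s - a ≠ 0) :
    ∃ l, δ.IsLog l (var k U s - a) := by
  obtain ⟨P, hP, h⟩ : IsAlgebraic (RatField k m) (var k U s - a) :=
    (isAlgebraic_algebraMap _).sub (isAlgebraic_ratField ha)
  exact (splits_and_exists_log hU P).2 _ h hP hne

variable [CharZero U]

/-- The integral of a rational function with respect to its last variable `x_{s+1}`. It is written
with logarithms of polynomials, as in `IsLogCoeff`, and with logarithms of linear factors, on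
which the different integrals can be compared. -/
theorem exists_integral_isLogCoeff (hU : δ.IsUniversal) {log : U → U}
    (h1 : ∀ b l, δ.IsLog l b → δ.IsLog (log b) b)
    (h2 : ∀ a b l l', δ.IsLog l a → δ.IsLog l' b → log (a * b) = log a + log b)
    (s : Fin m) {f : U} (hf : f ∈ firstVars k m U (s + 1)) :
    ∃ b ∈ firstVars k m U (s + 1), ∃ (T : Finset (algebraicClosure (firstVars k m U s) U))
      (c : algebraicClosure (firstVars k m U s) U → algebraicClosure (firstVars k m U s) U),
      f = δ.D s b + ∑ α ∈ T, algebraMap _ U (c α) / (var k U s - algebraMap _ U α) ∧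
      δ.IsLogCoeff log s
        (b + ∑ α ∈ T, algebraMap _ U (c α) * log (var k U s - algebraMap _ U α)) := by
  classical
  obtain ⟨b, hb, T, c, hfb, hP⟩ := exists_integral (D_algebraMap_firstVars s)
    (by rw [D_var, if_pos rfl] : δ.D s (var k U s) = 1) (splits_of_firstVars hU)
    (mem_firstVars_succ_iff.1 hf)
  refine ⟨b, mem_firstVars_succ_iff.2 hb, T, c, hfb, ?_⟩
  have hlog : ∀ S : Finset (algebraicClosure (firstVars k m U s) U), ∀ α ∈ S,
      ∃ l, δ.IsLog l (var k U s - algebraMap _ U α) := fun S α _ =>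
    exists_log_var_sub hU (mem_algebraicClosure_iff.1 α.2) (var_sub_ne_zero δ α)
  let e := (T.image c).equivFin
  let γ : Fin (T.image c).card → algebraicClosure (firstVars k m U s) U := fun j => e.symm j
  refine ⟨(T.image c).card, b, fun j => algebraMap _ U (γ j),
    fun j => ∏ α ∈ T with c α = γ j, (var k U s - algebraMap _ U α),
    mem_firstVars_succ_iff.2 hb, fun j => mem_algebraicClosure_iff.1 (γ j).2, fun j => hP (γ j),
    fun j => (log_prod h1 h2 _ _ (hlog _)).2, ?_⟩
  congr 1
  have h3 : ∀ γ, log (∏ α ∈ T with c α = γ, (var k U s - algebraMap _ U α)) =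
      ∑ α ∈ T with c α = γ, log (var k U s - algebraMap _ U α) := fun γ =>
    (log_prod h1 h2 _ _ (hlog _)).1
  simp only [h3]
  rw [← Finset.sum_fiberwise_of_maps_to (t := T.image c) (g := c)
    (fun α hα => Finset.mem_image_of_mem c hα), ← Finset.sum_coe_sort (T.image c)]
  refine (Fintype.sum_equiv e.symm _ _ fun j => ?_).symm
  rw [Finset.mul_sum]
  refine Finset.sum_congr rfl fun α hα => ?_
  rw [(Finset.mem_filter.1 hα).2]

/-- Simultaneous integration, with respect to `x_{s+1}`, of finitely many rational functions of the
variables up to `x_{s+1}`. The last property, for the integer matrix `w` of an operator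
`∑ t J, w t J • ∂_t`, says that a rational function `β` compatible with the `f J` is compatible with
their integrals up to a function of the variables before `x_{s+1}`. -/
theorem exists_integrals (hU : δ.IsUniversal) {log : U → U}
    (h1 : ∀ b l, δ.IsLog l b → δ.IsLog (log b) b)
    (h2 : ∀ a b l l', δ.IsLog l a → δ.IsLog l' b → log (a * b) = log a + log b)
    (s : Fin m) {κ : Type*} [Fintype κ] (f : κ → U) (hf : ∀ J, f J ∈ firstVars k m U (s + 1)) :
    ∃ G : κ → U, (∀ J, δ.IsLogCoeff log s (G J)) ∧ (∀ J, δ.D s (G J) = f J) ∧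
      (∀ J, ∀ t, s < t → δ.D t (G J) = 0) ∧
      ∀ (w : Fin m → κ → ℤ) (β : U), β ∈ firstVars k m U (s + 1) →
        δ.D s β = ∑ t ∈ Finset.Iio s, ∑ J, w t J • δ.D t (f J) →
        β - ∑ t ∈ Finset.Iio s, ∑ J, w t J • δ.D t (G J) ∈ firstVars k m U s := by
  classical
  choose b hb T c hfb hG using fun J => exists_integral_isLogCoeff hU h1 h2 s (hf J)
  have hx : δ.D s (var k U s) = 1 := by rw [D_var, if_pos rfl]
  have hlog : ∀ α : algebraicClosure (firstVars k m U s) U,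
      δ.IsLog (log (var k U s - algebraMap _ U α)) (var k U s - algebraMap _ U α) := fun α => by
    obtain ⟨l, hl⟩ := exists_log_var_sub hU (mem_algebraicClosure_iff.1 α.2) (var_sub_ne_zero δ α)
    exact h1 _ _ hl
  -- extend the residues by zero to a common set of poles
  let T' := Finset.univ.biUnion T
  let c' := fun J α => if α ∈ T J then c J α else 0
  have hext : ∀ J (g : algebraicClosure (firstVars k m U s) U → U),
      ∑ α ∈ T J, algebraMap _ U (c J α) * g α = ∑ α ∈ T', algebraMap _ U (c' J α) * g α :=
    fun J g => by
      have hsub : T J ⊆ T' := Finset.subset_biUnion_of_mem T (Finset.mem_univ J)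
      rw [← Finset.sum_subset hsub fun α _ hα => by simp only [c', if_neg hα, map_zero, zero_mul]]
      exact Finset.sum_congr rfl fun α hα => by simp only [c', if_pos hα]
  have hfb' : ∀ J, f J = δ.D s (b J) +
      ∑ α ∈ T', algebraMap _ U (c' J α) / (var k U s - algebraMap _ U α) := fun J => by
    rw [hfb J]
    simp only [div_eq_mul_inv]
    rw [hext J fun α => (var k U s - algebraMap _ U α)⁻¹]
  have hDA : ∀ t : Fin m, s ≤ t → ∀ α : algebraicClosure (firstVars k m U s) U,
      δ.D t (algebraMap _ U α) = 0 := fun t hst α =>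
    derivation_eq_zero_of_isAlgebraic
      (fun a : firstVars k m U s => D_eq_zero_of_mem_firstVars hst a.2)
      (mem_algebraicClosure_iff.1 α.2)
  refine ⟨fun J => b J + ∑ α ∈ T', algebraMap _ U (c' J α) *
    log (var k U s - algebraMap _ U α), fun J => ?_, fun J => ?_, fun J t ht => ?_,
    fun w β hβ hDβ => ?_⟩
  · simpa only [hext J fun α => log (var k U s - algebraMap _ U α)] using hG J
  · rw [hfb' J, map_add, map_sum]
    congr 1
    refine Finset.sum_congr rfl fun α _ => ?_
    rw [Derivation.leibniz, (hlog α).2, map_sub, hx, hDA s le_rfl, hDA s le_rfl]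
    simp [div_eq_mul_inv]
  · rw [map_add, map_sum, D_eq_zero_of_mem_firstVars (Nat.succ_le_of_lt ht) (hb J), zero_add]
    refine Finset.sum_eq_zero fun α _ => ?_
    rw [Derivation.leibniz, (hlog α).2, map_sub, D_var, if_neg ht.ne', hDA t ht.le, hDA t ht.le]
    simp
  · have hsum : ∀ g : κ → U, ∑ t ∈ Finset.Iio s, ∑ J, w t J • δ.D t (g J) =
        ∑ l : {t // t ∈ Finset.Iio s} × κ, (w l.1 l.2 • δ.D l.1) (g l.2) := fun g => by
      rw [Fintype.sum_prod_type, Finset.sum_coe_sort (Finset.Iio s)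
        (fun t => ∑ J, (w t J • δ.D t) (g J))]
      rfl
    rw [hsum] at hDβ ⊢
    have hlt : ∀ l : {t // t ∈ Finset.Iio s} × κ, (l.1 : Fin m) < s :=
      fun l => Finset.mem_Iio.1 l.1.2
    let δ' : {t // t ∈ Finset.Iio s} × κ → Derivation ℤ U U := fun l => w l.1 l.2 • δ.D l.1
    refine sub_sum_derivation_integral_mem (D := δ.D s)
      (fun a ha => D_eq_zero_of_mem_firstVars le_rfl ha) hx Finset.univ
      δ' (fun l u => ?_) (fun l a ha => ?_) (fun l => ?_) T'
      (fun α => log (var k U s - algebraMap _ U α)) (fun α _ l => ?_)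
      (fun l => f l.2) (fun l => b l.2) (fun l => c' l.2)
      (fun l => mem_firstVars_succ_iff.1 (hb l.2)) (fun l => hfb' l.2)
      (mem_firstVars_succ_iff.1 hβ) hDβ <;> simp only [δ']
    · rw [Derivation.smul_apply, Derivation.smul_apply, map_zsmul, δ.comm]
    · rw [Derivation.smul_apply]
      exact zsmul_mem (D_mem_firstVars _ _ ha) _
    · rw [Derivation.smul_apply, D_var, if_neg (hlt l).ne, smul_zero]
    · rw [Derivation.smul_apply, Derivation.smul_apply, (hlog α).2, zsmul_eq_mul, zsmul_eq_mul,
        mul_div_assoc]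

end Differential

/-! ### Coefficients of forms -/

section Forms

universe v

variable {m : ℕ} {E : Type v} [Field E]

variable (m E) in
/-- The basis `dx_I` of the space of `p`-forms. -/
noncomputable abbrev formBasis (p : ℕ) : Module.Basis (Set.powersetCard (Fin m) p) E (Form m E p) :=
  (Pi.basisFun E (Fin m)).exteriorPower p

theorem coeff_eq_coord {p : ℕ} (ω : Form m E p) (I : Set.powersetCard (Fin m) p) :
    coeff ω I = (formBasis m E p).coord I ω := rfl

theorem form_ext {p : ℕ} {ω η : Form m E p} (h : ∀ I, coeff ω I = coeff η I) : ω = η :=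
  (formBasis m E p).ext_elem h

theorem sum_coeff_smul {p : ℕ} (ω : Form m E p) : ∑ I, coeff ω I • formBasis m E p I = ω :=
  (formBasis m E p).sum_repr ω

theorem coeff_sum_smul {p : ℕ} (f : Set.powersetCard (Fin m) p → E)
    (I : Set.powersetCard (Fin m) p) : coeff (∑ I, f I • formBasis m E p I) I = f I :=
  congrFun ((formBasis m E p).repr_sum_self f) I

theorem formBasis_apply {p : ℕ} (I : Set.powersetCard (Fin m) p) : formBasis m E p I =
    exteriorPower.ιMulti E p fun j => dx (Set.powersetCard.ofFinEmbEquiv.symm I j) :=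
  exteriorPower.basis_apply ..

/-! ### Exterior multiplication by `dx_i` -/

/-- Exterior multiplication by `dx_{s+1}` on the left. -/
noncomputable def wedge (s : Fin m) {p : ℕ} : Form m E p →ₗ[E] Form m E (p + 1) :=
  ((LinearMap.mulLeft E (ExteriorAlgebra.ι E (dx (E := E) s))).comp
    (Submodule.subtype _)).codRestrict _ fun ω => by
      have h : ExteriorAlgebra.ι E (dx (E := E) s) ∈ LinearMap.range (ExteriorAlgebra.ι E
        (M := Fin m → E)) := ⟨_, rfl⟩
      rw [ExteriorAlgebra.exteriorPower, pow_succ']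
      exact Submodule.mul_mem_mul h ω.2

theorem coe_wedge (s : Fin m) {p : ℕ} (ω : Form m E p) :
    (wedge s ω : ExteriorAlgebra E (Fin m → E)) =
      ExteriorAlgebra.ι E (dx s) * (ω : ExteriorAlgebra E (Fin m → E)) := rfl

theorem wedge_ιMulti (s : Fin m) {p : ℕ} (v : Fin p → Fin m → E) :
    wedge s (exteriorPower.ιMulti E p v) = exteriorPower.ιMulti E (p + 1) (Fin.cons (dx s) v) := by
  apply Subtype.ext
  rw [coe_wedge, exteriorPower.ιMulti_apply_coe, exteriorPower.ιMulti_apply_coe,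
    ExteriorAlgebra.ιMulti_succ_apply]
  rfl

theorem wedge_wedge_self (s : Fin m) {p : ℕ} (ω : Form m E p) : wedge s (wedge s ω) = 0 := by
  apply Subtype.ext
  rw [coe_wedge, coe_wedge, ← mul_assoc, ExteriorAlgebra.ι_sq_zero, zero_mul]
  rfl

theorem wedge_wedge_comm (s t : Fin m) {p : ℕ} (ω : Form m E p) :
    wedge s (wedge t ω) = -wedge t (wedge s ω) := by
  apply Subtype.ext
  have := ExteriorAlgebra.ι_add_mul_swap (R := E) (dx (E := E) s) (dx t)
  rw [Submodule.coe_neg, coe_wedge, coe_wedge, coe_wedge, coe_wedge, ← mul_assoc, ← mul_assoc,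
    ← neg_mul, eq_neg_of_add_eq_zero_left this]

/-- The coefficient of `dx_{s+1} ∧ dx_J` at `dx_I`. It is recorded as an integer, so that
derivations visibly commute with exterior multiplication. -/
def wedgeInt (s : Fin m) {p : ℕ} (J : Set.powersetCard (Fin m) p)
    (I : Set.powersetCard (Fin m) (p + 1)) : ℤ :=
  (Matrix.of fun i j =>
    if (Fin.cons s (Set.powersetCard.ofFinEmbEquiv.symm J) : Fin (p + 1) → Fin m) i =
      Set.powersetCard.ofFinEmbEquiv.symm I j then (1 : ℤ) else 0).det

theorem coeff_wedge_formBasis (s : Fin m) {p : ℕ} (J : Set.powersetCard (Fin m) p)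
    (I : Set.powersetCard (Fin m) (p + 1)) :
    coeff (wedge s (formBasis m E p J)) I = wedgeInt s J I := by
  rw [formBasis_apply, wedge_ιMulti, coeff, exteriorPower.basis_repr_apply,
    exteriorPower.ιMultiDual_apply_ιMulti, wedgeInt, Int.cast_det]
  congr 1
  ext i j
  simp only [Matrix.of_apply, Matrix.map_apply]
  refine Fin.cases ?_ (fun i => ?_) i <;>
    simp [dx, Pi.single_apply, eq_comm]

theorem coeff_wedge (s : Fin m) {p : ℕ} (ω : Form m E p) (I : Set.powersetCard (Fin m) (p + 1)) :
    coeff (wedge s ω) I = ∑ J, wedgeInt s J I • coeff ω J := by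
  conv_lhs => rw [← sum_coeff_smul ω, coeff_eq_coord, map_sum, map_sum]
  refine Finset.sum_congr rfl fun J _ => ?_
  rw [map_smul, map_smul, ← coeff_eq_coord, coeff_wedge_formBasis, smul_eq_mul, zsmul_eq_mul,
    mul_comm]

/-- Up to sign, `dx_{s+1} ∧ dx_J` is the basis element for `insert s J`. -/
theorem wedge_formBasis (s : Fin m) {p : ℕ} (J : Set.powersetCard (Fin m) p)
    (I : Set.powersetCard (Fin m) (p + 1)) (hI : I.1 = insert s J.1) (hs : s ∉ J.1) :
    ∃ ε : ℤˣ, wedge s (formBasis m E p J) = ε • formBasis m E (p + 1) I := by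
  -- the sign is that of the permutation that sorts `s` into `J`
  set f : Fin (p + 1) → Fin m := Fin.cons s (Set.powersetCard.ofFinEmbEquiv.symm J) with hf
  set g : Fin (p + 1) → Fin m := ⇑(Set.powersetCard.ofFinEmbEquiv.symm I) with hg
  have hJ : ∀ i, i ∈ Set.range (Set.powersetCard.ofFinEmbEquiv.symm J) ↔ i ∈ J.1 :=
    fun i => Set.powersetCard.mem_range_ofFinEmbEquiv_symm_iff_mem J i
  have hfi : Function.Injective f := by
    rw [hf, Fin.cons_injective_iff]
    exact ⟨fun h => hs ((hJ s).1 h), (Set.powersetCard.ofFinEmbEquiv.symm J).injective⟩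
  have hgi : Function.Injective g := (Set.powersetCard.ofFinEmbEquiv.symm I).injective
  have hrange : Set.range f = Set.range g := by
    ext i
    rw [hg, Set.powersetCard.mem_range_ofFinEmbEquiv_symm_iff_mem, hf, Fin.range_cons]
    change _ ↔ i ∈ I.1
    rw [hI, Finset.mem_insert, Set.mem_insert_iff, hJ]
  let σ : Equiv.Perm (Fin (p + 1)) := (Equiv.ofInjective f hfi).trans
    ((Equiv.setCongr hrange).trans (Equiv.ofInjective g hgi).symm)
  have hσ : ∀ i, g (σ i) = f i := fun i => Equiv.apply_ofInjective_symm hgi _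
  refine ⟨Equiv.Perm.sign σ, ?_⟩
  rw [formBasis_apply, formBasis_apply, wedge_ιMulti, ← AlternatingMap.map_perm]
  congr 1
  ext i : 1
  simp only [Function.comp]
  change _ = dx (g (σ i))
  rw [hσ, hf]
  refine Fin.cases rfl (fun i => rfl) i

theorem wedge_formBasis_of_mem (s : Fin m) {p : ℕ} (J : Set.powersetCard (Fin m) p) (hs : s ∈ J.1) :
    wedge s (formBasis m E p J) = 0 := by
  obtain ⟨j, hj⟩ := (Set.powersetCard.mem_range_ofFinEmbEquiv_symm_iff_mem J s).2 hs
  rw [formBasis_apply, wedge_ιMulti]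
  exact (exteriorPower.ιMulti E (p + 1)).map_eq_zero_of_eq _ (i := 0) (j := j.succ)
    (by simp [hj]) (Fin.succ_ne_zero j).symm

/-! ### Forms in the first differentials -/

variable (m E) in
/-- The forms in `dx_1, …, dx_r` only. -/
noncomputable def formsBelow (r p : ℕ) : Submodule E (Form m E p) :=
  Submodule.span E (formBasis m E p '' {I | ∀ i ∈ I.1, (i : ℕ) < r})

theorem mem_formsBelow_iff {r p : ℕ} {ω : Form m E p} :
    ω ∈ formsBelow m E r p ↔
      ∀ I : Set.powersetCard (Fin m) p, ¬ (∀ i ∈ I.1, (i : ℕ) < r) → coeff ω I = 0 := by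
  rw [formsBelow, Module.Basis.mem_span_image]
  constructor
  · intro h I hI
    by_contra hne
    exact hI (h (Finsupp.mem_support_iff.2 hne))
  · intro h I hI
    by_contra hI'
    exact Finsupp.mem_support_iff.1 hI (h I hI')

/-- There is no nonzero form of degree `p` in fewer than `p` variables. -/
theorem formsBelow_eq_zero {r p : ℕ} (hr : r < p) {ω : Form m E p}
    (hω : ω ∈ formsBelow m E r p) : ω = 0 := by
  refine form_ext fun I => ?_
  rw [mem_formsBelow_iff.1 hω I fun hI => ?_]
  · simp [coeff]
  · have h1 : (I.1.map Fin.valEmbedding).card ≤ (Finset.range r).card :=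
      Finset.card_le_card fun i hi => by
        obtain ⟨j, hj, rfl⟩ := Finset.mem_map.1 hi
        exact Finset.mem_range.2 (hI j hj)
    have h2 : I.1.card = p := I.2
    rw [Finset.card_map, Finset.card_range] at h1
    omega

theorem mem_formsBelow_card {p : ℕ} (ω : Form m E p) : ω ∈ formsBelow m E m p :=
  mem_formsBelow_iff.2 fun _ hI => absurd (fun i _ => i.2) hI

theorem wedge_mem_formsBelow {r : ℕ} {t : Fin m} (ht : (t : ℕ) < r) {p : ℕ} {ω : Form m E p}
    (hω : ω ∈ formsBelow m E r p) : wedge t ω ∈ formsBelow m E r (p + 1) := by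
  have h : formsBelow m E r p ≤ (formsBelow m E r (p + 1)).comap (wedge t) := by
    refine Submodule.span_le.2 ?_
    rintro _ ⟨J, hJ, rfl⟩
    by_cases htJ : t ∈ J.1
    · change wedge t (formBasis m E p J) ∈ formsBelow m E r (p + 1)
      rw [wedge_formBasis_of_mem (E := E) t J htJ]
      exact zero_mem (formsBelow m E r (p + 1))
    · have hcard : (insert t J.1).card = p + 1 := by
        rw [Finset.card_insert_of_notMem htJ, (J.2 : J.1.card = p)]
      obtain ⟨ε, hε⟩ := wedge_formBasis (E := E) t J ⟨insert t J.1, hcard⟩ rfl htJ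
      change wedge t (formBasis m E p J) ∈ formsBelow m E r (p + 1)
      rw [hε, Units.smul_def]
      have hI : formBasis m E (p + 1) ⟨insert t J.1, hcard⟩ ∈ formsBelow m E r (p + 1) := by
        refine Submodule.subset_span ⟨_, fun i hi => ?_, rfl⟩
        rcases Finset.mem_insert.1 hi with rfl | hi
        · exact ht
        · exact hJ i hi
      exact zsmul_mem hI _
  exact h hω

/-- A form in `dx_1, …, dx_{s+1}` is `dx_{s+1} ∧ α + β`, with forms `α`, `β` in `dx_1, …, dx_s`. -/
theorem exists_eq_wedge_add (F : Subfield E) (s : Fin m) {p : ℕ} {ω : Form m E (p + 1)}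
    (hω : ω ∈ formsBelow m E (s + 1) (p + 1)) (hF : ∀ I, coeff ω I ∈ F) :
    ∃ α ∈ formsBelow m E s p, ∃ β ∈ formsBelow m E s (p + 1),
      (∀ J, coeff α J ∈ F) ∧ (∀ I, coeff β I ∈ F) ∧ ω = wedge s α + β := by
  classical
  have hsingle : ∀ {p : ℕ} (c : E) (_ : c ∈ F) (I J : Set.powersetCard (Fin m) p),
      coeff (c • formBasis m E p I) J ∈ F := fun c hc I J => by
    rw [coeff_eq_coord, map_smul, Module.Basis.coord_apply, Module.Basis.repr_self,
      Finsupp.single_apply, smul_eq_mul]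
    split_ifs
    · rwa [mul_one]
    · rw [mul_zero]; exact zero_mem _
  rw [← sum_coeff_smul ω]
  refine Finset.sum_induction _ (fun ω => ∃ α ∈ formsBelow m E s p,
      ∃ β ∈ formsBelow m E s (p + 1), (∀ J, coeff α J ∈ F) ∧ (∀ I, coeff β I ∈ F) ∧
      ω = wedge s α + β) ?_ ?_ fun I _ => ?_
  · rintro _ _ ⟨α, hα, β, hβ, hα', hβ', rfl⟩ ⟨γ, hγ, η, hη, hγ', hη', rfl⟩
    refine ⟨α + γ, add_mem hα hγ, β + η, add_mem hβ hη, fun J => ?_, fun J => ?_, ?_⟩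
    · rw [coeff_eq_coord, map_add]; exact add_mem (hα' J) (hγ' J)
    · rw [coeff_eq_coord, map_add]; exact add_mem (hβ' J) (hη' J)
    · rw [map_add]; abel
  · refine ⟨0, zero_mem _, 0, zero_mem _, fun J => ?_, fun J => ?_, by simp⟩ <;>
    · rw [coeff_eq_coord, map_zero]; exact zero_mem _
  · by_cases hI : ∀ i ∈ I.1, (i : ℕ) < s + 1
    · by_cases hs : s ∈ I.1
      · have hcard : (I.1.erase s).card = p := by
          rw [Finset.card_erase_of_mem hs, (I.2 : I.1.card = p + 1), Nat.add_sub_cancel]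
        obtain ⟨ε, hε⟩ := wedge_formBasis (E := E) s ⟨I.1.erase s, hcard⟩ I
          (Finset.insert_erase hs).symm (Finset.notMem_erase s I.1)
        refine ⟨((ε : ℤ) • coeff ω I) • formBasis m E p ⟨I.1.erase s, hcard⟩,
          Submodule.smul_mem _ _ (Submodule.subset_span ⟨_, fun i hi => ?_, rfl⟩), 0, zero_mem _,
          hsingle _ (zsmul_mem (hF I) _) _, fun J => ?_, ?_⟩
        · have h1 := hI i (Finset.mem_of_mem_erase hi)
          have h2 : (i : ℕ) ≠ s := fun h => Finset.ne_of_mem_erase hi (Fin.ext h)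
          omega
        · rw [coeff_eq_coord, map_zero]; exact zero_mem _
        · rw [map_smul, hε, add_zero, Units.smul_def, smul_assoc, smul_comm (coeff ω I) (ε : ℤ),
            smul_smul, ← Units.val_mul, Int.units_mul_self, Units.val_one, one_smul]
      · refine ⟨0, zero_mem _, coeff ω I • formBasis m E (p + 1) I,
          Submodule.smul_mem _ _ (Submodule.subset_span ⟨_, fun i hi => ?_, rfl⟩), fun J => ?_,
          hsingle _ (hF I) _, by simp⟩
        · have h1 := hI i hi
          have h2 : (i : ℕ) ≠ s := fun h => hs (Fin.ext h ▸ hi)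
          omega
        · rw [coeff_eq_coord, map_zero]; exact zero_mem _
    · rw [mem_formsBelow_iff.1 hω I hI, zero_smul]
      refine ⟨0, zero_mem _, 0, zero_mem _, fun J => ?_, fun J => ?_, by simp⟩ <;>
      · rw [coeff_eq_coord, map_zero]; exact zero_mem _

theorem contractLeft_ιMulti_eq_zero (d : Module.Dual E (Fin m → E)) {p : ℕ} (v : Fin p → Fin m → E)
    (hv : ∀ i, d (v i) = 0) :
    CliffordAlgebra.contractLeft (Q := 0) d (ExteriorAlgebra.ιMulti E p v) = 0 := by
  induction p with
  | zero =>
    rw [ExteriorAlgebra.ιMulti_zero_apply]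
    exact CliffordAlgebra.contractLeft_one _ d
  | succ p ih =>
    rw [ExteriorAlgebra.ιMulti_succ_apply]
    refine (CliffordAlgebra.contractLeft_ι_mul _ _ _).trans ?_
    rw [hv, zero_smul, zero_sub, neg_eq_zero]
    erw [ih _ fun i => hv _]
    rw [mul_zero]

theorem contractLeft_formsBelow_eq_zero (s : Fin m) {p : ℕ} {ω : Form m E p}
    (hω : ω ∈ formsBelow m E s p) :
    CliffordAlgebra.contractLeft (Q := 0) (LinearMap.proj s : Module.Dual E (Fin m → E))
      (ω : ExteriorAlgebra E (Fin m → E)) = 0 := by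
  induction hω using Submodule.span_induction with
  | mem x hx =>
    obtain ⟨I, hI, rfl⟩ := hx
    rw [formBasis_apply, exteriorPower.ιMulti_apply_coe]
    refine contractLeft_ιMulti_eq_zero _ _ fun i => ?_
    have h := hI _ ((Set.powersetCard.mem_range_ofFinEmbEquiv_symm_iff_mem I _).1 ⟨i, rfl⟩)
    have hne : s ≠ Set.powersetCard.ofFinEmbEquiv.symm I i := fun e => by
      rw [← e] at h; exact lt_irrefl _ h
    simp [dx, hne]
  | zero => exact map_zero _
  | add x y _ _ hx hy => exact (map_add _ _ _).trans (by rw [hx, hy, add_zero])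
  | smul a x _ hx => exact (map_smul _ _ _).trans (by rw [hx, smul_zero])

/-- The decomposition of `exists_eq_wedge_add` is unique: contract with the vector dual to
`dx_{s+1}`. -/
theorem eq_zero_of_wedge_add_eq_zero (s : Fin m) {p : ℕ} {α : Form m E p} {β : Form m E (p + 1)}
    (hα : α ∈ formsBelow m E s p) (hβ : β ∈ formsBelow m E s (p + 1)) (h : wedge s α + β = 0) :
    α = 0 := by
  have h1 := congrArg (fun ω : Form m E (p + 1) => CliffordAlgebra.contractLeft (Q := 0)
    (LinearMap.proj s : Module.Dual E (Fin m → E)) (ω : ExteriorAlgebra E (Fin m → E))) h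
  simp only [Submodule.coe_add, coe_wedge] at h1
  have h2 : CliffordAlgebra.contractLeft (Q := 0) (LinearMap.proj s : Module.Dual E (Fin m → E))
      (ExteriorAlgebra.ι E (dx s) * (α : ExteriorAlgebra E (Fin m → E))) = α := by
    refine (CliffordAlgebra.contractLeft_ι_mul _ _ _).trans ?_
    erw [contractLeft_formsBelow_eq_zero s hα]
    simp [dx]
  apply Subtype.ext
  refine h2.symm.trans ((add_zero _).symm.trans ?_)
  erw [← contractLeft_formsBelow_eq_zero s hβ]
  refine (map_add _ _ _).symm.trans (h1.trans ?_)
  exact map_zero _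

end Forms

/-! ### The exterior derivative -/

section ExteriorDerivative

universe u v

variable {k : Type u} [Field k] {m : ℕ} {U : Type v} [Field U]
  [Algebra (RatField k m) U] (δ : PartialDerivations k m U)

/-- The derivation `∂_{t+1}` acting on the coefficients of a form. -/
noncomputable def PartialDerivations.dCoeff (t : Fin m) {p : ℕ} (ω : Form m U p) : Form m U p :=
  ∑ I, δ.D t (coeff ω I) • formBasis m U p I

theorem coeff_dCoeff (t : Fin m) {p : ℕ} (ω : Form m U p) (I : Set.powersetCard (Fin m) p) :
    coeff (δ.dCoeff t ω) I = δ.D t (coeff ω I) := coeff_sum_smul _ I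

theorem coeff_add {p : ℕ} (ω η : Form m U p) (I : Set.powersetCard (Fin m) p) :
    coeff (ω + η) I = coeff ω I + coeff η I := by
  rw [coeff_eq_coord, map_add]; rfl

theorem coeff_sub {p : ℕ} (ω η : Form m U p) (I : Set.powersetCard (Fin m) p) :
    coeff (ω - η) I = coeff ω I - coeff η I := by
  rw [coeff_eq_coord, map_sub]; rfl

theorem coeff_zero {p : ℕ} (I : Set.powersetCard (Fin m) p) : coeff (0 : Form m U p) I = 0 := by
  rw [coeff_eq_coord, map_zero]

theorem coeff_sum {p : ℕ} {ι : Type*} (s : Finset ι) (ω : ι → Form m U p)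
    (I : Set.powersetCard (Fin m) p) : coeff (∑ i ∈ s, ω i) I = ∑ i ∈ s, coeff (ω i) I := by
  rw [coeff_eq_coord, map_sum]; rfl

theorem dCoeff_add (t : Fin m) {p : ℕ} (ω η : Form m U p) :
    δ.dCoeff t (ω + η) = δ.dCoeff t ω + δ.dCoeff t η :=
  form_ext fun I => by simp only [coeff_dCoeff, coeff_add, map_add]

theorem dCoeff_wedge (t s : Fin m) {p : ℕ} (ω : Form m U p) :
    δ.dCoeff t (wedge s ω) = wedge s (δ.dCoeff t ω) :=
  form_ext fun I => by simp only [coeff_dCoeff, coeff_wedge, map_sum, map_zsmul]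

theorem dCoeff_comm (t s : Fin m) {p : ℕ} (ω : Form m U p) :
    δ.dCoeff t (δ.dCoeff s ω) = δ.dCoeff s (δ.dCoeff t ω) :=
  form_ext fun I => by simp only [coeff_dCoeff, δ.comm t s]

theorem dCoeff_mem_formsBelow (t : Fin m) {r p : ℕ} {ω : Form m U p}
    (hω : ω ∈ formsBelow m U r p) : δ.dCoeff t ω ∈ formsBelow m U r p :=
  mem_formsBelow_iff.2 fun I hI => by rw [coeff_dCoeff, mem_formsBelow_iff.1 hω I hI, map_zero]

theorem dCoeff_eq_zero_of_firstVars {t : Fin m} {r : ℕ} (hrt : r ≤ t) {p : ℕ} {ω : Form m U p}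
    (hω : ∀ I, coeff ω I ∈ firstVars k m U r) : δ.dCoeff t ω = 0 :=
  form_ext fun I => by rw [coeff_dCoeff, D_eq_zero_of_mem_firstVars hrt (hω I), coeff_zero]

theorem dSingle_eq (t : Fin m) {p : ℕ} (ω : Form m U p) :
    δ.dSingle t ω = wedge t (δ.dCoeff t ω) := by
  rw [PartialDerivations.dSingle, PartialDerivations.dCoeff, map_sum]
  refine Finset.sum_congr rfl fun I _ => ?_
  rw [map_smul, formBasis_apply, wedge_ιMulti]

theorem d_eq {p : ℕ} (ω : Form m U p) : δ.d ω = ∑ t, wedge t (δ.dCoeff t ω) :=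
  Finset.sum_congr rfl fun t _ => dSingle_eq δ t ω

theorem d_add {p : ℕ} (ω η : Form m U p) : δ.d (ω + η) = δ.d ω + δ.d η := by
  simp only [d_eq, dCoeff_add, map_add, Finset.sum_add_distrib]

theorem d_zero {p : ℕ} : δ.d (0 : Form m U p) = 0 := by
  have := d_add δ (0 : Form m U p) 0
  rwa [add_zero, left_eq_add] at this

theorem d_sum {p : ℕ} {ι : Type*} (s : Finset ι) (ω : ι → Form m U p) :
    δ.d (∑ i ∈ s, ω i) = ∑ i ∈ s, δ.d (ω i) := by
  classical
  induction s using Finset.induction_on with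
  | empty => simp [d_zero]
  | insert i s hi ih => rw [Finset.sum_insert hi, Finset.sum_insert hi, d_add, ih]

theorem d_d [CharZero U] {p : ℕ} (ω : Form m U p) : δ.d (δ.d ω) = 0 := by
  have hadd : ∀ t, δ.dCoeff t (∑ u, wedge u (δ.dCoeff u ω)) =
      ∑ u, wedge u (δ.dCoeff t (δ.dCoeff u ω)) := fun t => by
    simp only [← dCoeff_wedge]
    refine form_ext fun I => ?_
    simp only [coeff_dCoeff, coeff_sum, map_sum]
  have h : δ.d (δ.d ω) = ∑ t, ∑ u, wedge t (wedge u (δ.dCoeff t (δ.dCoeff u ω))) := by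
    rw [d_eq, d_eq]
    exact Finset.sum_congr rfl fun t _ => by rw [hadd, map_sum]
  have h' : δ.d (δ.d ω) = -δ.d (δ.d ω) := by
    conv_lhs => rw [h, Finset.sum_comm]
    rw [h, ← Finset.sum_neg_distrib]
    refine Finset.sum_congr rfl fun t _ => ?_
    rw [← Finset.sum_neg_distrib]
    refine Finset.sum_congr rfl fun u _ => ?_
    rw [wedge_wedge_comm, dCoeff_comm]
  have h2 : (2 : U) • δ.d (δ.d ω) = 0 := by
    rw [two_smul]
    nth_rewrite 2 [h']
    exact add_neg_cancel _
  exact (smul_eq_zero.1 h2).resolve_left two_ne_zero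

/-- If `dx_{s+1} ∧ α + β` is closed, with rational forms `α`, `β` in `dx_1, …, dx_s` whose
coefficients do not involve the variables after `x_{s+1}`, then `∂_{s+1} β = d_s α`: compare the
terms with `dx_{s+1}`. -/
theorem dCoeff_eq_of_closed {s : Fin m} {p : ℕ} {α : Form m U p} {β : Form m U (p + 1)}
    (hα : α ∈ formsBelow m U s p) (hβ : β ∈ formsBelow m U s (p + 1))
    (hα' : ∀ J, coeff α J ∈ firstVars k m U (s + 1))
    (hβ' : ∀ I, coeff β I ∈ firstVars k m U (s + 1)) (hd : δ.d (wedge s α + β) = 0) :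
    δ.dCoeff s β = ∑ t ∈ Finset.Iio s, wedge t (δ.dCoeff t α) := by
  have hsplit : δ.d (wedge s α + β) = wedge s (δ.dCoeff s β) +
      ∑ t ∈ Finset.Iio s, wedge t (δ.dCoeff t (wedge s α + β)) := by
    rw [d_eq, ← Finset.sum_subset (Finset.subset_univ (Finset.Iic s)), ← Finset.Iio_insert,
      Finset.sum_insert Finset.notMem_Iio_self, dCoeff_add, dCoeff_wedge, map_add, wedge_wedge_self,
      zero_add]
    intro t _ ht
    have hst : (s : ℕ) + 1 ≤ t := not_le.1 fun h => ht (Finset.mem_Iic.2 h)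
    rw [dCoeff_add, dCoeff_wedge, dCoeff_eq_zero_of_firstVars δ hst hα',
      dCoeff_eq_zero_of_firstVars δ hst hβ', map_zero, add_zero, map_zero]
  have hlt : ∀ t ∈ Finset.Iio s, (t : ℕ) < s := fun t ht => (Finset.mem_Iio.1 ht : t < s)
  rw [← sub_eq_zero]
  refine eq_zero_of_wedge_add_eq_zero s (β := ∑ t ∈ Finset.Iio s, wedge t (δ.dCoeff t β))
    (sub_mem (dCoeff_mem_formsBelow δ s hβ) (sum_mem fun t ht =>
      wedge_mem_formsBelow (hlt t ht) (dCoeff_mem_formsBelow δ t hα)))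
    (sum_mem fun t ht => wedge_mem_formsBelow (hlt t ht) (dCoeff_mem_formsBelow δ t hβ)) ?_
  rw [← hd, hsplit, map_sub, map_sum, sub_add, sub_eq_add_neg]
  congr 1
  rw [← Finset.sum_sub_distrib, ← Finset.sum_neg_distrib]
  refine Finset.sum_congr rfl fun t _ => ?_
  rw [dCoeff_add, dCoeff_wedge, map_add, wedge_wedge_comm t s]
  abel

theorem isLogCoeff_zero (log : U → U) (s : Fin m) : δ.IsLogCoeff log s 0 :=
  ⟨0, 0, Fin.elim0, Fin.elim0, zero_mem _, fun j => j.elim0, fun j => j.elim0, fun j => j.elim0,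
    by simp⟩

/-! ### Elimination of the last variable -/

/-- Elimination of `x_{s+1}` and `dx_{s+1}` from a closed form, by integrating the coefficients of
`dx_{s+1}` with respect to `x_{s+1}`. -/
theorem exists_sub_d_mem [CharZero k] [CharZero U] (hU : δ.IsUniversal) {log : U → U}
    (h1 : ∀ b l, δ.IsLog l b → δ.IsLog (log b) b)
    (h2 : ∀ a b l l', δ.IsLog l a → δ.IsLog l' b → log (a * b) = log a + log b)
    (s : Fin m) {q : ℕ} {ω : Form m U (q + 1)} (hω : ω ∈ formsBelow m U (s + 1) (q + 1))
    (hrat : ∀ I, coeff ω I ∈ firstVars k m U (s + 1)) (hd : δ.d ω = 0) :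
    ∃ Ψ : Form m U q, (∀ I, δ.IsLogCoeff log s (coeff Ψ I)) ∧ δ.d Ψ = δ.dUpTo s Ψ ∧
      ω - δ.d Ψ ∈ formsBelow m U s (q + 1) ∧
      ∀ I, coeff (ω - δ.d Ψ) I ∈ firstVars k m U s := by
  classical
  obtain ⟨α, hα, β, hβ, hα', hβ', rfl⟩ := exists_eq_wedge_add _ s hω hrat
  have hβα := dCoeff_eq_of_closed δ hα hβ hα' hβ' hd
  obtain ⟨G, hG, hGs, hGt, hGw⟩ := exists_integrals hU h1 h2 s (fun J => coeff α J) hα'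
  -- `Ψ` integrates only the coefficients at those `dx_J` that can occur in `α`
  let B : Set.powersetCard (Fin m) q → Prop := fun J => ∀ i ∈ J.1, (i : ℕ) < s
  have hαB : ∀ J, ¬ B J → coeff α J = 0 := mem_formsBelow_iff.1 hα
  set Ψ : Form m U q := ∑ J, (if B J then G J else 0) • formBasis m U q J with hΨ
  have hcoeff : ∀ J, coeff Ψ J = if B J then G J else 0 := fun J => coeff_sum_smul _ J
  have hΨB : Ψ ∈ formsBelow m U s q := mem_formsBelow_iff.2 fun J hJ => by
    rw [hcoeff, if_neg hJ]
  have hΨt : ∀ t, s < t → δ.dCoeff t Ψ = 0 := fun t ht => form_ext fun J => by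
    rw [coeff_dCoeff, hcoeff, coeff_zero]
    split_ifs
    · exact hGt J t ht
    · exact map_zero _
  have hΨs : δ.dCoeff s Ψ = α := form_ext fun J => by
    rw [coeff_dCoeff, hcoeff]
    split_ifs with hJ
    · exact hGs J
    · rw [hαB J hJ, map_zero]
  have hup : δ.d Ψ = δ.dUpTo s Ψ := by
    rw [PartialDerivations.d, PartialDerivations.dUpTo]
    refine (Finset.sum_subset (Finset.subset_univ _) fun t _ ht => ?_).symm
    rw [dSingle_eq, hΨt t (not_le.1 fun h => ht (Finset.mem_Iic.2 h)), map_zero]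
  have hsub : wedge s α + β - δ.d Ψ = β - ∑ t ∈ Finset.Iio s, wedge t (δ.dCoeff t Ψ) := by
    have hΨd : δ.d Ψ = wedge s α + ∑ t ∈ Finset.Iio s, wedge t (δ.dCoeff t Ψ) := by
      rw [hup, PartialDerivations.dUpTo, ← Finset.Iio_insert,
        Finset.sum_insert Finset.notMem_Iio_self, dSingle_eq, hΨs]
      exact congrArg _ (Finset.sum_congr rfl fun t _ => dSingle_eq δ t Ψ)
    rw [hΨd]
    abel
  have hlt : ∀ t ∈ Finset.Iio s, (t : ℕ) < s := fun t ht => (Finset.mem_Iio.1 ht : t < s)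
  refine ⟨Ψ, fun J => ?_, hup, ?_, fun I => ?_⟩
  · rw [hcoeff]
    split_ifs
    · exact hG J
    · exact isLogCoeff_zero δ log s
  · rw [hsub]
    exact sub_mem hβ (sum_mem fun t ht =>
      wedge_mem_formsBelow (hlt t ht) (dCoeff_mem_formsBelow δ t hΨB))
  · let w : Fin m → Set.powersetCard (Fin m) q → ℤ := fun t J => if B J then wedgeInt t J I else 0
    have h3 := hGw w (coeff β I) (hβ' I) (by
      have := congrArg (fun η => coeff η I) hβα
      simp only [coeff_dCoeff, coeff_sum, coeff_wedge] at this
      rw [this]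
      refine Finset.sum_congr rfl fun t _ => Finset.sum_congr rfl fun J _ => ?_
      by_cases hJ : B J
      · simp only [w, if_pos hJ]
      · rw [hαB J hJ, map_zero, smul_zero, smul_zero])
    rw [hsub, coeff_sub, coeff_sum]
    convert h3 using 3 with t ht
    rw [coeff_wedge]
    refine Finset.sum_congr rfl fun J _ => ?_
    rw [coeff_dCoeff, hcoeff]
    by_cases hJ : B J
    · simp only [w, if_pos hJ]
    · simp only [w, if_neg hJ, map_zero, smul_zero, zero_smul]

/-- A closed rational form of degree `q + 1` in the first `r` variables is exact, by successive
elimination of the last variable. The form `Ψ s` comes from the elimination of `x_{s+1}`, which is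
needed only for `q ≤ s < r`; the other ones are zero. -/
theorem exists_primitives [CharZero k] [CharZero U] (hU : δ.IsUniversal) {log : U → U}
    (h1 : ∀ b l, δ.IsLog l b → δ.IsLog (log b) b)
    (h2 : ∀ a b l l', δ.IsLog l a → δ.IsLog l' b → log (a * b) = log a + log b)
    {q : ℕ} (r : ℕ) (hr : r ≤ m) (ω : Form m U (q + 1)) (hω : ω ∈ formsBelow m U r (q + 1))
    (hrat : ∀ I, coeff ω I ∈ firstVars k m U r) (hd : δ.d ω = 0) :
    ∃ Ψ : Fin m → Form m U q, (∀ s, ∀ I, δ.IsLogCoeff log s (coeff (Ψ s) I)) ∧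
      (∀ s, δ.d (Ψ s) = δ.dUpTo s (Ψ s)) ∧ (∀ s : Fin m, (s : ℕ) < q → Ψ s = 0) ∧
      (∀ s : Fin m, r ≤ s → Ψ s = 0) ∧ ω = ∑ s, δ.d (Ψ s) := by
  have hzero : ∀ (r : ℕ) (ω : Form m U (q + 1)), ω = 0 → ∃ Ψ : Fin m → Form m U q,
      (∀ s, ∀ I, δ.IsLogCoeff log s (coeff (Ψ s) I)) ∧
      (∀ s, δ.d (Ψ s) = δ.dUpTo s (Ψ s)) ∧ (∀ s : Fin m, (s : ℕ) < q → Ψ s = 0) ∧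
      (∀ s : Fin m, r ≤ s → Ψ s = 0) ∧ ω = ∑ s, δ.d (Ψ s) := by
    rintro r _ rfl
    refine ⟨fun _ => 0, fun s I => ?_, fun s => ?_, fun _ _ => rfl, fun _ _ => rfl, ?_⟩
    · rw [coeff_zero]
      exact isLogCoeff_zero δ log s
    · rw [d_zero, PartialDerivations.dUpTo]
      refine (Finset.sum_eq_zero fun t _ => ?_).symm
      rw [dSingle_eq, show δ.dCoeff t (0 : Form m U q) = 0 from form_ext fun I => by
        rw [coeff_dCoeff, coeff_zero, map_zero], map_zero]
    · simp [d_zero]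
  induction r generalizing ω with
  | zero => exact hzero _ _ (formsBelow_eq_zero (Nat.succ_pos q) hω)
  | succ r ih =>
    by_cases hq : r < q
    · exact hzero _ _ (formsBelow_eq_zero (Nat.succ_lt_succ hq) hω)
    let s : Fin m := ⟨r, hr⟩
    obtain ⟨Φ, hΦ, hΦd, hΦω, hΦr⟩ := exists_sub_d_mem δ hU h1 h2 s hω hrat hd
    have hd' : δ.d (ω - δ.d Φ) = 0 := by
      have := d_add δ (ω - δ.d Φ) (δ.d Φ)
      rwa [sub_add_cancel, hd, d_d, add_zero, eq_comm] at this
    obtain ⟨Ψ, hΨ, hΨd, hΨq, hΨr, hω'⟩ := ih (Nat.le_of_succ_le hr) _ hΦω hΦr hd'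
    refine ⟨Function.update Ψ s Φ, fun t I => ?_, fun t => ?_, fun t ht => ?_, fun t ht => ?_, ?_⟩
    · by_cases h : t = s
      · subst h; rw [Function.update_self]; exact hΦ I
      · rw [Function.update_of_ne h]; exact hΨ t I
    · by_cases h : t = s
      · subst h; rw [Function.update_self]; exact hΦd
      · rw [Function.update_of_ne h]; exact hΨd t
    · rw [Function.update_of_ne]
      · exact hΨq t ht
      · rintro rfl; exact hq ht
    · rw [Function.update_of_ne]
      · exact hΨr t (Nat.le_of_succ_le ht)
      · rintro rfl; exact absurd ht (Nat.not_succ_le_self r)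
    · have h3 : ∑ t, δ.d (Function.update Ψ s Φ t) =
          δ.d Φ + ∑ t ∈ Finset.univ.erase s, δ.d (Ψ t) := by
        rw [← Finset.add_sum_erase _ _ (Finset.mem_univ s), Function.update_self]
        congr 1
        exact Finset.sum_congr rfl fun t ht => by
          rw [Function.update_of_ne (Finset.ne_of_mem_erase ht)]
      rw [h3]
      rw [← Finset.add_sum_erase _ _ (Finset.mem_univ s), hΨr s le_rfl, d_zero, zero_add] at hω'
      rw [← hω']
      abel

end ExteriorDerivative

end RationalForms

theorem mainTheorem2 {k : Type*} [Field k] [CharZero k] {m : ℕ}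
    {U : Type*} [Field U] [Algebra (RationalForms.RatField k m) U]
    (δ : RationalForms.PartialDerivations k m U) (hU : δ.IsUniversal)
    -- the degree of the form is `p = q + 1 ≥ 1`
    (q : ℕ) (ω : RationalForms.Form m U (q + 1))
    (hrat : ∀ I, RationalForms.coeff ω I ∈ (algebraMap (RationalForms.RatField k m) U).fieldRange)
    (hclosed : δ.d ω = 0) :
    -- `Ψ s` is `Ψ^i` with `i = s + 1`, so that `p ≤ i ≤ m` reads `q ≤ s`
    ∃ (log : U → U) (Ψ : Fin m → RationalForms.Form m U q),
      (∀ s : Fin m, q ≤ (s : ℕ) → ∀ I, δ.IsLogCoeff log s (RationalForms.coeff (Ψ s) I)) ∧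
      ω = ∑ s ∈ Finset.univ.filter (fun s : Fin m => q ≤ (s : ℕ)), δ.dUpTo s (Ψ s) ∧
      ω = δ.d (∑ s ∈ Finset.univ.filter (fun s : Fin m => q ≤ (s : ℕ)), Ψ s) := by
  have : CharZero U := charZero_of_injective_algebraMap
    (algebraMap (RationalForms.RatField k m) U).injective
  obtain ⟨log, h1, h2⟩ := RationalForms.exists_multiplicative_log δ
  obtain ⟨Ψ, hΨ, hΨd, hΨq, -, hω⟩ := RationalForms.exists_primitives δ hU h1 h2 m le_rfl ω
    (RationalForms.mem_formsBelow_card ω)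
    (fun I => RationalForms.fieldRange_le_firstVars (hrat I)) hclosed
  have hsum : ω = ∑ s ∈ Finset.univ.filter (fun s : Fin m => q ≤ (s : ℕ)), δ.d (Ψ s) := by
    rw [hω]
    refine (Finset.sum_subset (Finset.subset_univ _) fun s _ hs => ?_).symm
    rw [hΨq s (not_le.1 fun h => hs (Finset.mem_filter.2 ⟨Finset.mem_univ s, h⟩)),
      RationalForms.d_zero]
  refine ⟨log, Ψ, fun s _ I => hΨ s I, ?_, ?_⟩
  · rw [hsum]
    exact Finset.sum_congr rfl fun s _ => hΨd s
  · rw [RationalForms.d_sum]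
    exact hsum
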